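/- Let $N\ge 2$. For parameters $\alpha,\beta$ consider the generalized DTKQ equation $$\Big(\sum_{j=0}^{N}u_{n+j}+\beta\Big)\prod_{k=1}^{N-1}u_{n+k}=\alpha \qquad (1)$$ and the multilinear relation $$\tau_{n+N+3}\,\tau_{n+N}^2\prod_{j=1}^{N-1}\tau_{n+j}=\alpha\,\tau_{n+3}\tau_{n+N}\prod_{j=2}^{N+1}\tau_{n+j}-\beta\prod_{j=1}^{N+2}\tau_{n+j}-\tau_n\tau_{n+3}\prod_{j=3}^{N+2}\tau_{n+j}-\sum_{k=1}^{N-1}\tau_{n+k}\tau_{n+k+3}\prod_{\substack{1\le j\le N+2\\ j\ne k+1,k+2}}\tau_{n+j}. \qquad (2)$$ (a) Let $\alpha,\beta$ be elements of a field, $(\tau_m)_{m\in\mathbb Z}$ a sequence in this field, and $u_m=\dfrac{\tau_{m+3}\tau_m}{\tau_{m+2}\tau_{m+1}}$. Let $n\in\mathbb Z$ be such that the denominators of $u_n,\dots,u_{n+N}$ do not vanish, that is, $\tau_{n+1},\dots,\tau_{n+N+2}\ne 0$. If $\tau$ satisfies (2) at $n$, then $u$ satisfies (1) at $n$. In particular,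 if $\tau$ is nowhere zero and satisfies (2) for all $n$, then $u$ satisfies (1) for all $n$. (b) The relation (2), as a polynomial relation (left side minus right side) in independent variables $\tau_m$ over any field containing $\alpha,\beta$, is homogeneous of degree $N+2$ and of order $N+3$: the lowest and the highest index of a variable occurring in it are $n$ and $n+N+3$. (c) The recurrence (2) has the Laurent property. Let $\alpha,\beta,\tau_0,\dots,\tau_{N+2}$ be independent indeterminates. There is exactly one sequence $(\tau_n)_{n\in\mathbb Z}$ in the field $\mathbb Q(\alpha,\beta,\tau_0,\dots,\tau_{N+2})$ that extends the initial data $\tau_0,\dots,\tau_{N+2}$ and satisfies (2) for all $n\in\mathbb Z$; none of its terms is zero; and $$\tau_n\in\mathbb Z[\alpha,\beta,\tau_0^{\pm1},\dots,\tau_{N+2}^{\pm1}]\qquad\text{for all } n\in\mathbb Z.$$ -/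

import Mathlib

namespace GenDTKQ

/-- `u` satisfies the generalized DTKQ equation with parameters `α`, `β` at the index `n`:
`(u_n + ⋯ + u_{n+N} + β) u_{n+1} ⋯ u_{n+N-1} = α`. -/
def DTKQAt {F : Type*} [CommRing F] (N : ℕ) (α β : F) (u : ℤ → F) (n : ℤ) : Prop :=
  (∑ j ∈ Finset.Icc 0 N, u (n + j) + β) * ∏ k ∈ Finset.Icc 1 (N - 1), u (n + k) = α

/-- The substitution `u_n = τ_{n+3} τ_n / (τ_{n+2} τ_{n+1})`. -/
def tauSub {F : Type*} [Field F] (τ : ℤ → F) (n : ℤ) : F :=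
  (τ (n + 3) * τ n) / (τ (n + 2) * τ (n + 1))

/-- Left-hand side of the multilinear relation, `τ_{n+N+3} τ_{n+N}² ∏_{j=1}^{N-1} τ_{n+j}`. -/
def multiLHS {R : Type*} [CommRing R] (N : ℕ) (τ : ℤ → R) (n : ℤ) : R :=
  τ (n + N + 3) * τ (n + N) ^ 2 * ∏ j ∈ Finset.Icc 1 (N - 1), τ (n + j)

/-- Right-hand side of the multilinear relation. -/
def multiRHS {R : Type*} [CommRing R] (N : ℕ) (α β : R) (τ : ℤ → R) (n : ℤ) : R :=
  α * τ (n + 3) * τ (n + N) * ∏ j ∈ Finset.Icc 2 (N + 1), τ (n + j)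
    - β * ∏ j ∈ Finset.Icc 1 (N + 2), τ (n + j)
    - τ n * τ (n + 3) * ∏ j ∈ Finset.Icc 3 (N + 2), τ (n + j)
    - ∑ k ∈ Finset.Icc 1 (N - 1), τ (n + k) * τ (n + k + 3) *
        ∏ j ∈ Finset.Icc 1 (N + 2) \ {k + 1, k + 2}, τ (n + j)

/-- `τ` satisfies the multilinear relation at the index `n`. -/
def MultiAt {R : Type*} [CommRing R] (N : ℕ) (α β : R) (τ : ℤ → R) (n : ℤ) : Prop :=
  multiLHS N τ n = multiRHS N α β τ n

/-- The multilinear relation at `n` as a polynomial (left side minus right side) in independent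
variables `τ_m`, `m ∈ ℤ`, with coefficients in `R`. -/
noncomputable def multiPoly {R : Type*} [CommRing R] (N : ℕ) (α β : R) (n : ℤ) :
    MvPolynomial ℤ R :=
  multiLHS N MvPolynomial.X n
    - multiRHS N (MvPolynomial.C α) (MvPolynomial.C β) MvPolynomial.X n

/-- The field `ℚ(α, β, τ_0, …, τ_{N+2})` of rational functions in the two parameters (first
summand) and the `N + 3` initial data (second summand). -/
abbrev RatField (N : ℕ) : Type := FractionRing (MvPolynomial (Fin 2 ⊕ Fin (N + 3)) ℤ)

/-- The indeterminate `α`. -/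
noncomputable def alphaVar (N : ℕ) : RatField N :=
  algebraMap (MvPolynomial (Fin 2 ⊕ Fin (N + 3)) ℤ) (RatField N) (MvPolynomial.X (Sum.inl 0))

/-- The indeterminate `β`. -/
noncomputable def betaVar (N : ℕ) : RatField N :=
  algebraMap (MvPolynomial (Fin 2 ⊕ Fin (N + 3)) ℤ) (RatField N) (MvPolynomial.X (Sum.inl 1))

/-- The indeterminate initial datum `τ_i`, `0 ≤ i ≤ N + 2`. -/
noncomputable def tauVar (N : ℕ) (i : Fin (N + 3)) : RatField N :=
  algebraMap (MvPolynomial (Fin 2 ⊕ Fin (N + 3)) ℤ) (RatField N) (MvPolynomial.X (Sum.inr i))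

/-- The ring `ℤ[α, β, τ_0^{±1}, …, τ_{N+2}^{±1}]`. -/
noncomputable def laurentRing (N : ℕ) : Subring (RatField N) :=
  Subring.closure
    ({alphaVar N, betaVar N} ∪ Set.range (tauVar N) ∪ Set.range (fun i => (tauVar N i)⁻¹))

/-- `τ` is a two-sided sequence of iterates of the multilinear recurrence with indeterminate
parameters, started from the indeterminate initial data `τ_0, …, τ_{N+2}`. -/
def IsGenericOrbit (N : ℕ) (τ : ℤ → RatField N) : Prop :=
  (∀ i : Fin (N + 3), τ ((i : ℕ) : ℤ) = tauVar N i) ∧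
    ∀ n : ℤ, MultiAt N (alphaVar N) (betaVar N) τ n

end GenDTKQ

namespace GenDTKQ

/-! ### The multilinear relation and its form as a sum of the quotients u -/

section Basic

variable {R S : Type*} [CommRing R] [CommRing S]

/-! Divided by `τ_{n+1} ⋯ τ_{n+N+2}`, the multilinear relation says that `u_n + ⋯ + u_{n+N} + β`
equals `α τ_{n+3} τ_{n+N} / (τ_{n+1} τ_{n+N+2})` (`multiLHS_sub_multiRHS`). The product `u_{n+1} ⋯
u_{n+N-1}` telescopes to the inverse of the cofactor of `α`, which gives (a). Part (b) is a degree
count together with evaluations near the all-ones point.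

The Laurent property comes from singularity confinement. Subtracting consecutive relations leaves
the four-term relation `quartic`. With its help, `confinement` shows that when an orbit passes
through a single non-unit of a ring of fractions, the numerators over that non-unit cancel, and the
next `N + 3` terms are regular again.

By induction, `IsGenericOrbit.mem_inner` proves more than Laurentness for `j ≥ 0`: `τ_j` is
polynomial in the parameters, the initial data, and the inverses of `τ_0, …, τ_{N+1}`; the last
datum `τ_{N+2}` is never inverted. Restarting the orbit at `τ_1` shows that the next term is Laurent
in the original data. Restarting at `τ_{N+3}`, beyond the singularity, shows that it is regular at a
point where `τ_{N+2} = 0`. As `τ_{N+2}` is a prime of the polynomial ring, it drops out of the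
denominator. Negative indices follow from the reversal symmetry `MultiAt.reverse`.

Statements about nonvanishing and specialization are obtained by running the generic orbit together
with an explicit one in a product ring, inside the subring of fractions with admissible common
denominators. The all-ones orbit shows that the generic orbit never vanishes; the orbit of an
arithmetic progression supplies the point needed for confinement. -/

theorem map_multiLHS (f : R →+* S) (N : ℕ) (τ : ℤ → R) (n : ℤ) :
    f (multiLHS N τ n) = multiLHS N (fun j => f (τ j)) n := by
  simp [multiLHS, map_prod]

theorem map_multiRHS (f : R →+* S) (N : ℕ) (α β : R) (τ : ℤ → R) (n : ℤ) :
    f (multiRHS N α β τ n) = multiRHS N (f α) (f β) (fun j => f (τ j)) n := by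
  simp [multiRHS, map_prod, map_sum]

/-- The cofactor of the term of highest index in the multilinear relation. -/
def topCoeff (N : ℕ) (τ : ℤ → R) (n : ℤ) : R :=
  τ (n + N) ^ 2 * ∏ j ∈ Finset.Icc 1 (N - 1), τ (n + j)

theorem multiLHS_eq (N : ℕ) (τ : ℤ → R) (n : ℤ) :
    multiLHS N τ n = τ (n + N + 3) * topCoeff N τ n := by
  rw [multiLHS, topCoeff, mul_assoc]

theorem topCoeff_one (N : ℕ) (n : ℤ) : topCoeff N (fun _ => (1 : R)) n = 1 := by
  simp [topCoeff]

theorem topCoeff_pair (N : ℕ) (τ : ℤ → R) (σ : ℤ → S) (n : ℤ) :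
    topCoeff N (fun j => (τ j, σ j)) n = (topCoeff N τ n, topCoeff N σ n) := by
  refine Prod.ext ?_ ?_ <;> simp [topCoeff, Prod.fst_prod, Prod.snd_prod]

theorem multiRHS_pair (N : ℕ) (α β : R) (a b : S) (τ : ℤ → R) (σ : ℤ → S) (n : ℤ) :
    multiRHS N (α, a) (β, b) (fun j => (τ j, σ j)) n =
      (multiRHS N α β τ n, multiRHS N a b σ n) :=
  Prod.ext (map_multiRHS (RingHom.fst R S) N (α, a) (β, b) (fun j => (τ j, σ j)) n)
    (map_multiRHS (RingHom.snd R S) N (α, a) (β, b) (fun j => (τ j, σ j)) n)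

theorem multiAt_pair {N : ℕ} {α β : R} {a b : S} {τ : ℤ → R} {σ : ℤ → S} {n : ℤ}
    (h₁ : MultiAt N α β τ n) (h₂ : MultiAt N a b σ n) :
    MultiAt N (α, a) (β, b) (fun j => (τ j, σ j)) n := by
  unfold MultiAt at *
  rw [multiLHS_eq] at *
  rw [multiRHS_pair, topCoeff_pair, Prod.mk_mul_mk, h₁, h₂]

theorem topCoeff_congr {N : ℕ} {τ σ : ℤ → R} {n : ℤ}
    (h : ∀ j, n ≤ j → j ≤ n + N + 2 → τ j = σ j) : topCoeff N τ n = topCoeff N σ n := by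
  unfold topCoeff
  rw [h (n + N) (by omega) (by omega)]
  congr 1
  refine Finset.prod_congr rfl fun j hj => ?_
  rw [Finset.mem_Icc] at hj
  exact h _ (by omega) (by omega)

theorem multiRHS_congr {N : ℕ} (hN : 2 ≤ N) {α β : R} {τ σ : ℤ → R} {n : ℤ}
    (h : ∀ j, n ≤ j → j ≤ n + N + 2 → τ j = σ j) :
    multiRHS N α β τ n = multiRHS N α β σ n := by
  have key : ∀ s : Finset ℕ, (∀ j ∈ s, j ≤ N + 2) →
      ∏ j ∈ s, τ (n + j) = ∏ j ∈ s, σ (n + j) := fun s hs =>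
    Finset.prod_congr rfl fun j hj => h _ (by omega) (by have := hs j hj; omega)
  unfold multiRHS
  rw [h n (by omega) (by omega), h (n + 3) (by omega) (by omega), h (n + N) (by omega) (by omega),
    key _ fun j hj => by rw [Finset.mem_Icc] at hj; omega,
    key (Finset.Icc 1 (N + 2)) fun j hj => by rw [Finset.mem_Icc] at hj; omega,
    key (Finset.Icc 3 (N + 2)) fun j hj => by rw [Finset.mem_Icc] at hj; omega]
  congr 1
  refine Finset.sum_congr rfl fun k hk => ?_
  rw [Finset.mem_Icc] at hk
  rw [h (n + k) (by omega) (by omega), h (n + k + 3) (by omega) (by omega),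
    key _ fun j hj => by rw [Finset.mem_sdiff, Finset.mem_Icc] at hj; omega]

theorem topCoeff_mem {N : ℕ} (T : Subring R) {τ : ℤ → R} {n : ℤ}
    (h : ∀ j, n ≤ j → j ≤ n + N + 2 → τ j ∈ T) : topCoeff N τ n ∈ T := by
  -- Setting the terms outside the window to zero makes the whole sequence `T`-valued without
  -- changing the coefficient.
  have := topCoeff_congr (N := N) (n := n) (τ := τ)
    (σ := fun j => T.subtype (if hj : n ≤ j ∧ j ≤ n + N + 2 then ⟨τ j, h j hj.1 hj.2⟩ else 0))
    fun j h₁ h₂ => by simp [h₁, h₂]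
  rw [this]
  refine T.mul_mem (T.pow_mem (Subtype.property _) _) (Subring.prod_mem _ fun j _ => ?_)
  exact Subtype.property _

theorem multiRHS_mem {N : ℕ} (hN : 2 ≤ N) (T : Subring R) {α β : R} (hα : α ∈ T) (hβ : β ∈ T)
    {τ : ℤ → R} {n : ℤ} (h : ∀ j, n ≤ j → j ≤ n + N + 2 → τ j ∈ T) :
    multiRHS N α β τ n ∈ T := by
  have := multiRHS_congr hN (α := α) (β := β) (n := n) (τ := τ)
    (σ := fun j => T.subtype (if hj : n ≤ j ∧ j ≤ n + N + 2 then ⟨τ j, h j hj.1 hj.2⟩ else 0))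
    fun j h₁ h₂ => by simp [h₁, h₂]
  rw [this]
  exact map_multiRHS T.subtype N ⟨α, hα⟩ ⟨β, hβ⟩ _ n ▸ Subtype.property _

theorem MultiAt.congr {N : ℕ} (hN : 2 ≤ N) {α β : R} {τ σ : ℤ → R} {n : ℤ}
    (H : MultiAt N α β τ n) (h : ∀ j, n ≤ j → j ≤ n + N + 3 → τ j = σ j) :
    MultiAt N α β σ n := by
  unfold MultiAt at *
  rw [multiLHS_eq] at *
  rw [← multiRHS_congr hN (τ := τ) fun j h₁ h₂ => h j h₁ (by omega),
    ← topCoeff_congr (τ := τ) fun j h₁ h₂ => h j h₁ (by omega), ← h _ (by omega) (by omega), H]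

theorem MultiAt.shift {N : ℕ} {α β : R} {τ : ℤ → R} {n : ℤ} (c : ℤ)
    (H : MultiAt N α β τ (n + c)) : MultiAt N α β (fun j => τ (j + c)) n := by
  have e : ∀ x : ℤ, n + x + c = n + c + x := fun x => by ring
  have e' : ∀ x y : ℤ, n + x + y + c = n + c + x + y := fun x y => by ring
  unfold MultiAt multiLHS multiRHS at *
  simp only [e, e']
  exact H

/-- The difference of the two sides of the multilinear relation, divided by
`τ_{n+1} ⋯ τ_{n+N+2}`; here `ι` holds inverses of `τ`. -/
theorem multiLHS_sub_multiRHS {N : ℕ} (hN : 2 ≤ N) (α β : R) (z ι : ℤ → R) (n : ℤ)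
    (h : ∀ j ∈ Finset.Icc 1 (N + 2), z (n + (j : ℤ)) * ι (n + (j : ℤ)) = 1) :
    multiLHS N z n - multiRHS N α β z n = (∏ j ∈ Finset.Icc 1 (N + 2), z (n + j)) *
      (∑ j ∈ Finset.Icc 0 N, z (n + j + 3) * z (n + j) * (ι (n + j + 2) * ι (n + j + 1)) + β
        - α * z (n + 3) * z (n + N) * (ι (n + 1) * ι (n + N + 2))) := by
  obtain ⟨M, rfl⟩ : ∃ M, N = M + 2 := ⟨N - 2, by omega⟩
  have e1 : M + 2 - 1 = M + 1 := rfl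
  unfold multiLHS multiRHS
  rw [e1]
  set P := ∏ j ∈ Finset.Icc 1 (M + 2 + 2), z (n + j) with hP
  have p0 : P = (∏ j ∈ Finset.Icc 1 (M + 1), z (n + j)) *
      z (n + M + 2) * z (n + M + 2 + 1) * z (n + M + 2 + 2) := by
    rw [hP, Finset.prod_Icc_succ_top (by omega), Finset.prod_Icc_succ_top (by omega),
      Finset.prod_Icc_succ_top (by omega)]
    push_cast
    ring_nf
  have p1 : P = z (n + 1) * (∏ j ∈ Finset.Icc 2 (M + 2 + 1), z (n + j)) * z (n + M + 2 + 2) := by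
    rw [hP, Finset.prod_Icc_succ_top (by omega), ← Finset.mul_prod_Ioc_eq_prod_Icc (by omega),
      show Finset.Ioc 1 (M + 2 + 1) = Finset.Icc 2 (M + 2 + 1) from rfl]
    push_cast
    ring_nf
  have p2 : P = z (n + 1) * (z (n + 2) * ∏ j ∈ Finset.Icc 3 (M + 2 + 2), z (n + j)) := by
    rw [hP, ← Finset.mul_prod_Ioc_eq_prod_Icc (by omega)]
    congr 1
  have p3 : ∀ k ∈ Finset.Icc 1 (M + 1), z (n + k) * z (n + k + 3) *
      ∏ j ∈ Finset.Icc 1 (M + 2 + 2) \ {k + 1, k + 2}, z (n + j) =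
      P * (z (n + k + 3) * z (n + k) * (ι (n + k + 2) * ι (n + k + 1))) := by
    intro k hk
    rw [Finset.mem_Icc] at hk
    have hs : ({k + 1, k + 2} : Finset ℕ) ⊆ Finset.Icc 1 (M + 2 + 2) := by
      intro x hx
      simp only [Finset.mem_insert, Finset.mem_singleton] at hx
      rw [Finset.mem_Icc]; omega
    have h1 := h (k + 1) (by rw [Finset.mem_Icc]; omega)
    have h2 := h (k + 2) (by rw [Finset.mem_Icc]; omega)
    rw [hP, ← Finset.prod_sdiff hs, Finset.prod_pair (by omega)]
    push_cast at h1 h2 ⊢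
    rw [← add_assoc] at h1 h2
    rw [← add_assoc, ← add_assoc]
    linear_combination (-(z (n + k) * z (n + k + 3) *
      ∏ j ∈ Finset.Icc 1 (M + 2 + 2) \ {k + 1, k + 2}, z (n + j))) *
      (h2 + z (n + k + 2) * ι (n + k + 2) * h1)
  rw [Finset.sum_congr rfl p3, ← Finset.mul_sum]
  have s0 : ∑ j ∈ Finset.Icc 0 (M + 2),
      z (n + j + 3) * z (n + j) * (ι (n + j + 2) * ι (n + j + 1)) =
      z (n + 3) * z n * (ι (n + 2) * ι (n + 1)) +
      ∑ j ∈ Finset.Icc 1 (M + 1), z (n + j + 3) * z (n + j) * (ι (n + j + 2) * ι (n + j + 1)) +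
      z (n + M + 2 + 3) * z (n + M + 2) * (ι (n + M + 2 + 2) * ι (n + M + 2 + 1)) := by
    rw [Finset.sum_Icc_succ_top (by omega), ← Finset.add_sum_Ioc_eq_sum_Icc (by omega)]
    push_cast
    simp only [add_zero, add_assoc]
    rfl
  rw [s0]
  have h1 := h 1 (by rw [Finset.mem_Icc]; omega)
  have h2 := h 2 (by rw [Finset.mem_Icc]; omega)
  have h3 := h (M + 3) (by rw [Finset.mem_Icc]; omega)
  have h4 := h (M + 4) (by rw [Finset.mem_Icc]; omega)
  have e3 : n + ((M + 3 : ℕ) : ℤ) = n + M + 2 + 1 := by push_cast; ring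
  have e4 : n + ((M + 4 : ℕ) : ℤ) = n + M + 2 + 2 := by push_cast; ring
  rw [e3] at h3
  rw [e4] at h4
  have e2 : n + ((M + 2 : ℕ) : ℤ) = n + M + 2 := by push_cast; ring
  rw [e2]
  push_cast at h1 h2
  have t0 : P * (z (n + M + 2 + 3) * z (n + M + 2) * (ι (n + M + 2 + 2) * ι (n + M + 2 + 1))) =
      z (n + M + 2 + 3) * z (n + M + 2) ^ 2 * ∏ j ∈ Finset.Icc 1 (M + 1), z (n + j) := by
    rw [p0]
    linear_combination (z (n + M + 2 + 3) * z (n + M + 2) ^ 2 *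
      ∏ j ∈ Finset.Icc 1 (M + 1), z (n + j)) * (h3 + z (n + M + 2 + 1) * ι (n + M + 2 + 1) * h4)
  have t1 : P * (α * z (n + 3) * z (n + M + 2) * (ι (n + 1) * ι (n + M + 2 + 2))) =
      α * z (n + 3) * z (n + M + 2) * ∏ j ∈ Finset.Icc 2 (M + 2 + 1), z (n + j) := by
    rw [p1]
    linear_combination (α * z (n + 3) * z (n + M + 2) *
      ∏ j ∈ Finset.Icc 2 (M + 2 + 1), z (n + j)) * (h1 + z (n + 1) * ι (n + 1) * h4)
  have t2 : P * (z (n + 3) * z n * (ι (n + 2) * ι (n + 1))) =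
      z n * z (n + 3) * ∏ j ∈ Finset.Icc 3 (M + 2 + 2), z (n + j) := by
    rw [p2]
    linear_combination (z n * z (n + 3) * ∏ j ∈ Finset.Icc 3 (M + 2 + 2), z (n + j)) *
      (h1 + z (n + 1) * ι (n + 1) * h2)
  linear_combination t1 - t0 - t2

end Basic

/-! ### Reversal symmetry -/

section Reversal

variable {R : Type*} [CommRing R]

theorem prod_reflect (N : ℕ) (τ : ℤ → R) (n : ℤ) (s s' : Finset ℕ)
    (h : ∀ j ∈ s, j ≤ N + 3 ∧ N + 3 - j ∈ s') (h' : ∀ j ∈ s', j ≤ N + 3 ∧ N + 3 - j ∈ s) :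
    ∏ j ∈ s, τ (n + N + 3 - j) = ∏ j ∈ s', τ (n + j) := by
  refine Finset.prod_nbij' (fun j => N + 3 - j) (fun j => N + 3 - j)
    (fun j hj => (h j hj).2) (fun j hj => (h' j hj).2) (fun j hj => ?_) (fun j hj => ?_)
    (fun j hj => ?_)
  · have := (h j hj).1
    omega
  · have := (h' j hj).1
    omega
  · have := (h j hj).1
    congr 1
    push_cast [this]
    ring

/-- The reflection `j ↦ N + 3 - j` of the window exchanges the top term with the `τ_n` term and
preserves the `α` term, the `β` term and the sum. Backward iteration thus reduces to forward
iteration. -/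
theorem MultiAt.reverse {N : ℕ} (hN : 2 ≤ N) {α β : R} {τ : ℤ → R} {n : ℤ}
    (H : MultiAt N α β τ n) (c : ℤ) :
    MultiAt N α β (fun j => τ (c - j)) (c - n - N - 3) := by
  have e : ∀ x : ℤ, c - (c - n - N - 3 + x) = n + N + 3 - x := fun x => by ring
  have e0 : c - (c - n - N - 3) = n + N + 3 := by ring
  have e' : ∀ x y : ℤ, c - (c - n - N - 3 + x + y) = n + N + 3 - x - y := fun x y => by ring
  unfold MultiAt multiLHS multiRHS at *
  simp only [e, e', e0]
  rw [prod_reflect N τ n (Finset.Icc 1 (N - 1)) (Finset.Icc 4 (N + 2)),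
    prod_reflect N τ n (Finset.Icc 2 (N + 1)) (Finset.Icc 2 (N + 1)),
    prod_reflect N τ n (Finset.Icc 1 (N + 2)) (Finset.Icc 1 (N + 2)),
    prod_reflect N τ n (Finset.Icc 3 (N + 2)) (Finset.Icc 1 N)]
  rotate_left
  iterate 8 (intro j hj; rw [Finset.mem_Icc] at *; omega)
  have hs : ∑ k ∈ Finset.Icc 1 (N - 1), τ (n + N + 3 - k) * τ (n + N + 3 - k - 3) *
        ∏ j ∈ Finset.Icc 1 (N + 2) \ {k + 1, k + 2}, τ (n + N + 3 - j) =
      ∑ k ∈ Finset.Icc 1 (N - 1), τ (n + k) * τ (n + k + 3) *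
        ∏ j ∈ Finset.Icc 1 (N + 2) \ {k + 1, k + 2}, τ (n + j) := by
    refine Finset.sum_nbij' (fun k => N - k) (fun k => N - k) ?_ ?_ ?_ ?_ ?_ <;> intro k hk <;>
      rw [Finset.mem_Icc] at hk
    · rw [Finset.mem_Icc]; omega
    · rw [Finset.mem_Icc]; omega
    · omega
    · omega
    · rw [prod_reflect N τ n _ (Finset.Icc 1 (N + 2) \ {N - k + 1, N - k + 2})]
      · rw [show n + (N : ℤ) + 3 - k - 3 = n + ((N - k : ℕ) : ℤ) by omega,
          show n + (N : ℤ) + 3 - k = n + ((N - k : ℕ) : ℤ) + 3 by omega]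
        ring
      all_goals
        intro j hj
        simp only [Finset.mem_sdiff, Finset.mem_Icc, Finset.mem_insert, Finset.mem_singleton] at *
        omega
  rw [hs]
  have a1 : ∏ j ∈ Finset.Icc 3 (N + 2), τ (n + j) =
      τ (n + 3) * ∏ j ∈ Finset.Icc 4 (N + 2), τ (n + j) := by
    rw [← Finset.mul_prod_Ioc_eq_prod_Icc (by omega)]
    rfl
  have a2 : ∏ j ∈ Finset.Icc 1 N, τ (n + j) =
      (∏ j ∈ Finset.Icc 1 (N - 1), τ (n + j)) * τ (n + N) := by
    obtain ⟨M, rfl⟩ : ∃ M, N = M + 1 := ⟨N - 1, by omega⟩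
    rw [Finset.prod_Icc_succ_top (by omega)]
    rfl
  rw [a1] at H
  rw [a2, show n + (N : ℤ) + 3 - N = n + 3 by ring, show n + (N : ℤ) + 3 - 3 = n + N by ring,
    show n + 3 - 3 = n by ring]
  linear_combination H

theorem reverse_orbit {N : ℕ} {α β : R} {τ : ℤ → R} (H : ∀ n, MultiAt N α β τ n) (hN : 2 ≤ N)
    (n : ℤ) : MultiAt N α β (fun j => τ (N + 2 - j)) n := by
  have := (H (-1 - n)).reverse hN (N + 2)
  rwa [show (N : ℤ) + 2 - (-1 - n) - N - 3 = n by ring] at this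

end Reversal

/-! ### The four-term relation -/

section Quartic

variable {D : Type*} [CommRing D]

theorem MultiAt.sum_eq {N : ℕ} (hN : 2 ≤ N) {α β : D} {z ι : ℤ → D} (h : ∀ j, z j * ι j = 1)
    {n : ℤ} (H : MultiAt N α β z n) :
    ∑ j ∈ Finset.Icc 0 N, z (n + j + 3) * z (n + j) * (ι (n + j + 2) * ι (n + j + 1)) + β =
      α * z (n + 3) * z (n + N) * (ι (n + 1) * ι (n + N + 2)) := by
  have h₁ := multiLHS_sub_multiRHS hN α β z ι n fun j _ => h _
  rw [sub_eq_zero.2 H] at h₁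
  have h₂ : (∏ j ∈ Finset.Icc 1 (N + 2), ι (n + j)) * (∏ j ∈ Finset.Icc 1 (N + 2), z (n + j)) = 1 := by
    rw [← Finset.prod_mul_distrib]
    exact Finset.prod_eq_one fun j _ => by rw [mul_comm]; exact h _
  rw [← sub_eq_zero]
  linear_combination (-(∏ j ∈ Finset.Icc 1 (N + 2), ι (n + j))) * h₁ - (∑ j ∈ Finset.Icc 0 N,
    z (n + j + 3) * z (n + j) * (ι (n + j + 2) * ι (n + j + 1)) + β -
      α * z (n + 3) * z (n + N) * (ι (n + 1) * ι (n + N + 2))) * h₂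

theorem sum_Icc_shift_sub (f : ℤ → D) (n : ℤ) (N : ℕ) :
    ∑ j ∈ Finset.Icc 0 N, f (n + 1 + j) - ∑ j ∈ Finset.Icc 0 N, f (n + j) =
      f (n + N + 1) - f n := by
  rw [← Finset.sum_sub_distrib]
  induction N with
  | zero => simp
  | succ k ih =>
    rw [Finset.sum_Icc_succ_top (by omega), ih]
    push_cast
    rw [show n + 1 + ((k : ℤ) + 1) = n + (k + 1) + 1 by ring, ← add_assoc n (k : ℤ) 1]
    ring

/-- Clears the denominators in the difference of two consecutive relations, where `β` and all but
the two end terms of the sums have cancelled. -/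
theorem clear_four {A B C E α p q r s ip iq ir is : D} (hp : p * ip = 1) (hq : q * iq = 1)
    (hr : r * ir = 1) (hs : s * is = 1)
    (h : A * (is * ir) - B * (iq * ip) = α * C * (iq * is) - α * E * (ip * ir)) :
    A * (p * q) = r * (B * s + α * C * p) - α * E * q * s := by
  grind

/-- Two consecutive instances of the multilinear relation give a relation with four terms. -/
theorem quartic {N : ℕ} (hN : 2 ≤ N) {α β : D} {z ι : ℤ → D} (h : ∀ j, z j * ι j = 1)
    {n : ℤ} (H : MultiAt N α β z n) (H' : MultiAt N α β z (n + 1)) :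
    z (n + N + 4) * z (n + N + 1) * (z (n + 1) * z (n + 2)) =
      z (n + N + 2) * (z (n + 3) * z n * z (n + N + 3) + α * (z (n + 4) * z (n + N + 1)) * z (n + 1))
        - α * (z (n + 3) * z (n + N)) * z (n + 2) * z (n + N + 3) := by
  have h₁ := H.sum_eq hN h
  have h₂ := H'.sum_eq hN h
  have h₃ := sum_Icc_shift_sub (fun j => z (j + 3) * z j * (ι (j + 2) * ι (j + 1))) n N
  rw [show n + 1 + 3 = n + 4 by ring, show n + 1 + (N : ℤ) = n + N + 1 by ring,
    show n + 1 + 1 = n + 2 by ring, show n + (N : ℤ) + 1 + 2 = n + N + 3 by ring] at h₂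
  rw [show n + (N : ℤ) + 1 + 3 = n + N + 4 by ring, show n + (N : ℤ) + 1 + 2 = n + N + 3 by ring,
    show n + (N : ℤ) + 1 + 1 = n + N + 2 by ring] at h₃
  exact clear_four (h _) (h _) (h _) (h _)
    (by linear_combination h₂ - h₁ - h₃)

end Quartic

/-! ### Singularity confinement -/

section Confinement

variable {D : Type*} [CommRing D]

/-- A forward step divides only by the terms of indices `n + 1, …, n + N`, so the last two terms of
the window may be non-units. -/
theorem next_mem {N : ℕ} (hN : 2 ≤ N) (T : Subring D) {α β : D} (hα : α ∈ T) (hβ : β ∈ T)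
    {z ι : ℤ → D} (h : ∀ j, z j * ι j = 1) {n : ℤ} (H : MultiAt N α β z n)
    (hz : ∀ j, n ≤ j → j ≤ n + N + 2 → z j ∈ T) (hι : ∀ j, n + 1 ≤ j → j ≤ n + N → ι j ∈ T) :
    z (n + N + 3) ∈ T := by
  have h₁ : topCoeff N z n * topCoeff N ι n = 1 := by
    unfold topCoeff
    rw [mul_mul_mul_comm, ← mul_pow, h, one_pow, ← Finset.prod_mul_distrib,
      Finset.prod_eq_one fun j _ => h _, one_mul]
  have h₂ : topCoeff N ι n ∈ T := by
    refine T.mul_mem (T.pow_mem (hι _ (by omega) (by omega)) _) (Subring.prod_mem _ fun j hj => ?_)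
    rw [Finset.mem_Icc] at hj
    exact hι _ (by omega) (by omega)
  have h₃ : z (n + N + 3) = multiRHS N α β z n * topCoeff N ι n := by
    rw [← show _ = _ from H, multiLHS_eq, mul_assoc, h₁, mul_one]
  rw [h₃]
  exact T.mul_mem (multiRHS_mem hN T hα hβ hz) h₂

/-- Singularity confinement: if a solution passes through the value `z 0`, which need not be
invertible in the subring `T`, while its other values in `T` are invertible there, then
the next `N + 3` values stay in `T`. -/
theorem confinement {N : ℕ} (hN : 2 ≤ N) (T : Subring D) {α β : D} (hα : α ∈ T) (hβ : β ∈ T)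
    {z ι : ℤ → D} (h : ∀ j, z j * ι j = 1) (H : ∀ n, MultiAt N α β z n)
    (hz : ∀ j, -(N + 2 : ℤ) ≤ j → j ≤ 0 → z j ∈ T) (hι : ∀ j, j ≠ 0 → z j ∈ T → ι j ∈ T) :
    ∀ j : ℤ, -(N + 2 : ℤ) ≤ j → j ≤ N + 3 → z j ∈ T := by
  -- The quotients `u_j` with `j ≤ -3` do not have `z 0` in the denominator.
  have hu : ∀ j : ℤ, -(N + 2 : ℤ) ≤ j → j ≤ -3 →
      z (j + 3) * z j * (ι (j + 2) * ι (j + 1)) ∈ T := fun j h₁ h₂ =>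
    T.mul_mem (T.mul_mem (hz _ (by omega) (by omega)) (hz _ (by omega) (by omega)))
      (T.mul_mem (hι _ (by omega) (hz _ (by omega) (by omega)))
        (hι _ (by omega) (hz _ (by omega) (by omega))))
  have hz1 : z 1 ∈ T := by
    have := next_mem hN T hα hβ h (H (-N - 2)) (fun j _ _ => hz j (by omega) (by omega))
      (fun j _ _ => hι j (by omega) (hz j (by omega) (by omega)))
    rwa [show -(N : ℤ) - 2 + N + 3 = 1 by ring] at this
  have hz' : ∀ j, -(N + 2 : ℤ) ≤ j → j ≤ 1 → z j ∈ T := fun j _ _ => by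
    rcases eq_or_ne j 1 with rfl | hj
    · exact hz1
    · exact hz j (by omega) (by omega)
  have hz2 : z 2 ∈ T := by
    have := next_mem hN T hα hβ h (H (-N - 1)) (fun j _ _ => hz' j (by omega) (by omega))
      (fun j _ _ => hι j (by omega) (hz j (by omega) (by omega)))
    rwa [show -(N : ℤ) - 1 + N + 3 = 2 by ring] at this
  -- `w`, `y` and `x` below are the quotients by `z 0` of three expressions that vanish with it
  obtain ⟨w, hw, ew⟩ : ∃ w ∈ T, z 1 * z (-N - 1) - α * z (1 - N) * z (-1) = z 0 * w := by
    -- Here only `u_{-2}` and the `α` term have `z 0` in the denominator, so their polar parts must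
    -- cancel.
    have h₁ := (H (-N - 2)).sum_eq hN h
    obtain ⟨M, rfl⟩ : ∃ M, N = M + 1 := ⟨N - 1, by omega⟩
    rw [Finset.sum_Icc_succ_top (by omega)] at h₁
    have hs : ∑ j ∈ Finset.Icc 0 M, z (-((M + 1 : ℕ) : ℤ) - 2 + j + 3) *
        z (-((M + 1 : ℕ) : ℤ) - 2 + j) *
        (ι (-((M + 1 : ℕ) : ℤ) - 2 + j + 2) * ι (-((M + 1 : ℕ) : ℤ) - 2 + j + 1)) ∈ T :=
      Subring.sum_mem _ fun j hj => by
        rw [Finset.mem_Icc] at hj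
        exact hu _ (by omega) (by omega)
    set s := ∑ j ∈ Finset.Icc 0 M, z (-((M + 1 : ℕ) : ℤ) - 2 + j + 3) *
        z (-((M + 1 : ℕ) : ℤ) - 2 + j) *
        (ι (-((M + 1 : ℕ) : ℤ) - 2 + j + 2) * ι (-((M + 1 : ℕ) : ℤ) - 2 + j + 1))
    refine ⟨-(s + β) * z (-1) * z (-((M + 1 : ℕ) : ℤ) - 1) * ι (-2),
      T.mul_mem (T.mul_mem (T.mul_mem (T.neg_mem (T.add_mem hs hβ)) (hz _ (by omega) (by omega)))
        (hz _ (by omega) (by omega))) (hι _ (by omega) (hz _ (by omega) (by omega))), ?_⟩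
    generalize ((M + 1 : ℕ) : ℤ) = c at *
    rw [show -c - 2 + c + 3 = 1 by ring, show -c - 2 + c = -2 by ring,
      show -c - 2 + 3 = 1 - c by ring, show -c - 2 + 1 = -c - 1 by ring,
      show (-2 : ℤ) + 1 = -1 by ring, show (-2 : ℤ) + 2 = 0 by ring] at h₁
    have i0 := h 0
    have i1 := h (-1)
    have i2 := h (-2)
    have i3 := h (-c - 1)
    clear_value s
    grind
  obtain ⟨y, hy, ey⟩ : ∃ y ∈ T, z 1 ^ 2 * z (-2) + z 2 * z (-1) ^ 2 = z 0 * y := by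
    -- Here the terms with `z 0` in the denominator are `u_{-2}` and `u_{-1}`.
    have h₁ := (H (-N - 1)).sum_eq hN h
    obtain ⟨M, rfl⟩ : ∃ M, N = M + 2 := ⟨N - 2, by omega⟩
    rw [Finset.sum_Icc_succ_top (by omega), Finset.sum_Icc_succ_top (by omega)] at h₁
    have hs : ∑ j ∈ Finset.Icc 0 M, z (-((M + 2 : ℕ) : ℤ) - 1 + j + 3) *
        z (-((M + 2 : ℕ) : ℤ) - 1 + j) *
        (ι (-((M + 2 : ℕ) : ℤ) - 1 + j + 2) * ι (-((M + 2 : ℕ) : ℤ) - 1 + j + 1)) ∈ T :=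
      Subring.sum_mem _ fun j hj => by
        rw [Finset.mem_Icc] at hj
        exact hu _ (by omega) (by omega)
    set s := ∑ j ∈ Finset.Icc 0 M, z (-((M + 2 : ℕ) : ℤ) - 1 + j + 3) *
        z (-((M + 2 : ℕ) : ℤ) - 1 + j) *
        (ι (-((M + 2 : ℕ) : ℤ) - 1 + j + 2) * ι (-((M + 2 : ℕ) : ℤ) - 1 + j + 1))
    refine ⟨z (-1) * (α * z (2 - (M + 2 : ℕ)) * z (-1) * ι (-(M + 2 : ℕ)) - z 1 * (s + β)),
      T.mul_mem (hz _ (by omega) (by omega)) (T.sub_mem (T.mul_mem (T.mul_mem (T.mul_mem hα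
        (hz _ (by omega) (by omega))) (hz _ (by omega) (by omega)))
        (hι _ (by omega) (hz _ (by omega) (by omega)))) (T.mul_mem hz1 (T.add_mem hs hβ))), ?_⟩
    have eM : ((M + 1 : ℕ) : ℤ) = ((M + 2 : ℕ) : ℤ) - 1 := by push_cast; ring
    rw [show (((M + 1 + 1 : ℕ)) : ℤ) = ((M + 2 : ℕ) : ℤ) from rfl, eM] at h₁
    generalize ((M + 2 : ℕ) : ℤ) = c at *
    rw [show -c - 1 + (c - 1) = -2 by ring, show -c - 1 + c = -1 by ring,
      show -c - 1 + 3 = 2 - c by ring, show -c - 1 + 1 = -c by ring,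
      show (-2 : ℤ) + 1 = -1 by ring, show (-2 : ℤ) + 2 = 0 by ring,
      show (-2 : ℤ) + 3 = 1 by ring, show (-1 : ℤ) + 1 = 0 by ring,
      show (-1 : ℤ) + 2 = 1 by ring, show (-1 : ℤ) + 3 = 2 by ring] at h₁
    have i0 := h 0
    have i1 := h 1
    have i2 := h (-1)
    clear_value s
    grind
  have hz3 : z 3 ∈ T := by
    have h₁ := quartic hN h (H (-N - 1)) (H _)
    -- The four-term relation determines `z 0 * z 3`; the terms without an explicit factor `z 0`
    -- combine into a multiple of the expression divided to form `w`, so `z 0` cancels.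
    have e : z 3 = (α * z 1 * z (-N) * z (3 - N) + z 2 * z (2 - N) * w) *
        (ι (-N) * ι (1 - N)) := by
      generalize (N : ℤ) = c at *
      rw [show -c - 1 + c + 4 = 3 by ring, show -c - 1 + c + 3 = 2 by ring,
        show -c - 1 + c + 2 = 1 by ring, show -c - 1 + c + 1 = 0 by ring,
        show -c - 1 + c = -1 by ring,
        show -c - 1 + 4 = 3 - c by ring, show -c - 1 + 3 = 2 - c by ring,
        show -c - 1 + 2 = 1 - c by ring, show -c - 1 + 1 = -c by ring] at h₁
      have i0 := h 0
      have i1 := h (-c)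
      have i2 := h (1 - c)
      have h₂ : z 0 * (z 3 * (z (-c) * z (1 - c))) =
          z 0 * (α * z 1 * z (-c) * z (3 - c) + z 2 * z (2 - c) * w) := by
        linear_combination h₁ + z 2 * z (2 - c) * ew
      grind
    rw [e]
    exact T.mul_mem (T.add_mem (T.mul_mem (T.mul_mem (T.mul_mem hα hz1) (hz _ (by omega)
      (by omega))) (hz' _ (by omega) (by omega))) (T.mul_mem (T.mul_mem hz2 (hz _ (by omega)
      (by omega))) hw)) (T.mul_mem (hι _ (by omega) (hz _ (by omega) (by omega)))
      (hι _ (by omega) (hz _ (by omega) (by omega))))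
  -- For `4 ≤ j ≤ N + 1` the four-term relation divides by the terms of indices `j - 3`, `j - N -
  -- 3`, `j - N - 2`, none of which is `0`. At `j = N + 2` the last would be `0`.
  have hmid : ∀ m : ℕ, ∀ j : ℤ, -(N + 2 : ℤ) ≤ j → j ≤ N + 1 → j ≤ m → z j ∈ T := by
    intro m
    induction m with
    | zero => exact fun j h₁ _ h₂ => hz j h₁ (by simpa using h₂)
    | succ m ih =>
      intro j h₁ h₂ h₃
      rcases lt_or_ge j (m + 1) with h₄ | h₄
      · exact ih j h₁ h₂ (by omega)
      rcases le_or_gt j 3 with h₅ | h₅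
      · have : j ≤ 0 ∨ j = 1 ∨ j = 2 ∨ j = 3 := by omega
        rcases this with h₆ | rfl | rfl | rfl
        exacts [hz j h₁ h₆, hz1, hz2, hz3]
      have q := quartic hN h (H (j - N - 4)) (H _)
      have hj : ∀ i, j - N - 4 ≤ i → i < j → z i ∈ T := fun i _ _ =>
        ih i (by omega) (by omega) (by omega)
      have e : z j = (z (j - N - 4 + N + 4) * z (j - N - 4 + N + 1) *
          (z (j - N - 4 + 1) * z (j - N - 4 + 2))) *
          (ι (j - N - 4 + N + 1) * ι (j - N - 4 + 1) * ι (j - N - 4 + 2)) := by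
        have i1 := h (j - N - 4 + N + 1)
        have i2 := h (j - N - 4 + 1)
        have i3 := h (j - N - 4 + 2)
        rw [show j - (N : ℤ) - 4 + N + 4 = j by ring]
        grind
      rw [e, q]
      refine T.mul_mem (T.sub_mem (T.mul_mem (hj _ (by omega) (by omega)) (T.add_mem (T.mul_mem
        (T.mul_mem (hj _ (by omega) (by omega)) (hj _ (by omega) (by omega)))
        (hj _ (by omega) (by omega))) (T.mul_mem (T.mul_mem hα
        (T.mul_mem (hj _ (by omega) (by omega)) (hj _ (by omega) (by omega))))
        (hj _ (by omega) (by omega))))) (T.mul_mem (T.mul_mem (T.mul_mem hα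
        (T.mul_mem (hj _ (by omega) (by omega)) (hj _ (by omega) (by omega))))
        (hj _ (by omega) (by omega))) (hj _ (by omega) (by omega)))) ?_
      exact T.mul_mem (T.mul_mem (hι _ (by omega) (hj _ (by omega) (by omega)))
        (hι _ (by omega) (hj _ (by omega) (by omega))))
        (hι _ (by omega) (hj _ (by omega) (by omega)))
  have hz'' : ∀ j : ℤ, -(N + 2 : ℤ) ≤ j → j ≤ N + 1 → z j ∈ T := fun j h₁ h₂ =>
    hmid (N + 1) j h₁ h₂ (by simpa using h₂)
  obtain ⟨x, hx, ex⟩ : ∃ x ∈ T, z (N + 1) * z (-1) - α * z (N - 1) * z 1 = z 0 * x := by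
    -- For `N ≥ 3` one divides by `z (N - 2)`. For `N = 2` this is `z 0`, which then cancels from
    -- the whole relation, and `w` supplies the remaining factor `z 0`.
    rcases hN.lt_or_eq with h3 | rfl
    · have q := quartic hN h (H (-3)) (H _)
      refine ⟨(z (N - 1) * z (-3) * z N - α * z (-1) * z (N - 3) * z N) * (ι (N - 2) * ι (-2)),
        T.mul_mem (T.sub_mem (T.mul_mem (T.mul_mem (hz'' _ (by omega) (by omega))
          (hz'' _ (by omega) (by omega))) (hz'' _ (by omega) (by omega)))
          (T.mul_mem (T.mul_mem (T.mul_mem hα (hz'' _ (by omega) (by omega)))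
          (hz'' _ (by omega) (by omega))) (hz'' _ (by omega) (by omega))))
          (T.mul_mem (hι _ (by omega) (hz'' _ (by omega) (by omega)))
          (hι _ (by omega) (hz'' _ (by omega) (by omega)))), ?_⟩
      generalize (N : ℤ) = c at *
      rw [show -3 + c + 4 = c + 1 by ring, show -3 + c + 3 = c by ring,
        show -3 + c + 2 = c - 1 by ring, show -3 + c + 1 = c - 2 by ring,
        show -3 + c = c - 3 by ring,
        show (-3 : ℤ) + 4 = 1 by ring, show (-3 : ℤ) + 3 = 0 by ring,
        show (-3 : ℤ) + 2 = -1 by ring, show (-3 : ℤ) + 1 = -2 by ring] at q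
      have i1 := h (c - 2)
      have i2 := h (-2)
      grind
    · have q := quartic hN h (H (-3)) (H _)
      refine ⟨z 2 * w * ι (-2), T.mul_mem (T.mul_mem hz2 hw)
        (hι _ (by omega) (hz'' _ (by omega) (by omega))), ?_⟩
      norm_num at q ew ⊢
      have i0 := h 0
      have i1 := h (-2)
      have h₂ : z 0 * (z (-2) * (z 3 * z (-1) - α * z 1 * z 1)) = z 0 * (z 2 * (z 0 * w)) := by
        linear_combination q + z 0 * z 2 * ew
      linear_combination ι 0 * ι (-2) * h₂ - (z 3 * z (-1) - α * z 1 * z 1) *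
        (i1 + z (-2) * ι (-2) * i0) + z 0 * z 2 * w * ι (-2) * i0
  have hz4 : z (N + 2) ∈ T := by
    have q := quartic hN h (H (-2)) (H _)
    have e : z (N + 2) = (z N * (z (N + 1) * y - z (-1) * z 2 * x) * ι 1 -
        α * z 1 * z (N - 2) * z (N + 1)) * (ι (N - 1) * ι (-1)) := by
      generalize (N : ℤ) = c at *
      rw [show -2 + c + 4 = c + 2 by ring, show -2 + c + 3 = c + 1 by ring,
        show -2 + c + 2 = c by ring, show -2 + c + 1 = c - 1 by ring,
        show -2 + c = c - 2 by ring,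
        show (-2 : ℤ) + 4 = 2 by ring, show (-2 : ℤ) + 3 = 1 by ring,
        show (-2 : ℤ) + 2 = 0 by ring, show (-2 : ℤ) + 1 = -1 by ring] at q
      have i0 := h 0
      have i1 := h 1
      have i2 := h (c - 1)
      have i3 := h (-1)
      -- This is the second cancellation: modulo `z 0`, the relations behind `y` and `x` make the
      -- bracket vanish after multiplication by the unit `z 1`.
      have hB : z 1 * (z 1 * z (-2) * z (c + 1) + α * (z 2 * z (c - 1)) * z (-1)) =
          z 0 * (z (c + 1) * y - z (-1) * z 2 * x) := by
        linear_combination z (c + 1) * ey - z (-1) * z 2 * ex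
      have h₂ : z 0 * (z (c + 2) * (z (c - 1) * z (-1))) =
          z 0 * (z c * (z (c + 1) * y - z (-1) * z 2 * x) * ι 1 -
            α * z 1 * z (c - 2) * z (c + 1)) := by
        linear_combination q + z c * ι 1 * hB - z c * (z 1 * z (-2) * z (c + 1) +
          α * (z 2 * z (c - 1)) * z (-1)) * i1
      have h₃ : z (c + 2) * (z (c - 1) * z (-1)) =
          z c * (z (c + 1) * y - z (-1) * z 2 * x) * ι 1 - α * z 1 * z (c - 2) * z (c + 1) := by
        linear_combination ι 0 * h₂ - (z (c + 2) * (z (c - 1) * z (-1)) -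
          (z c * (z (c + 1) * y - z (-1) * z 2 * x) * ι 1 -
            α * z 1 * z (c - 2) * z (c + 1))) * i0
      rw [← h₃]
      linear_combination (-z (c + 2)) * (i2 + z (c - 1) * ι (c - 1) * i3)
    rw [e]
    exact T.mul_mem (T.sub_mem (T.mul_mem (T.mul_mem (hz'' _ (by omega) (by omega))
      (T.sub_mem (T.mul_mem (hz'' _ (by omega) (by omega)) hy) (T.mul_mem (T.mul_mem
      (hz'' _ (by omega) (by omega)) hz2) hx))) (hι _ (by omega) hz1))
      (T.mul_mem (T.mul_mem (T.mul_mem hα hz1) (hz'' _ (by omega) (by omega)))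
      (hz'' _ (by omega) (by omega)))) (T.mul_mem (hι _ (by omega) (hz'' _ (by omega) (by omega)))
      (hι _ (by omega) (hz'' _ (by omega) (by omega))))
  have hz5 : ∀ j : ℤ, -(N + 2 : ℤ) ≤ j → j ≤ N + 2 → z j ∈ T := fun j h₁ h₂ => by
    rcases h₂.lt_or_eq with h₃ | rfl
    · exact hz'' j h₁ (by omega)
    · exact hz4
  intro j h₁ h₂
  rcases h₂.lt_or_eq with h₃ | rfl
  · exact hz5 j h₁ (by omega)
  · have := next_mem hN T hα hβ h (H 0) (fun j _ _ => hz5 j (by omega) (by omega))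
      (fun j _ _ => hι j (by omega) (hz5 j (by omega) (by omega)))
    rwa [zero_add] at this

end Confinement

/-! ### Fractions with prescribed denominators -/

section FracSubring

variable {R C C' : Type*} [CommRing R] [CommRing C] [CommRing C']

/-- The elements of `C` that are quotients of images of elements of `R`, with denominators
in `S`. -/
def fracSubring (f : R →+* C) (S : Submonoid R) : Subring C where
  carrier := {z | ∃ Q ∈ S, ∃ P, z * f Q = f P}
  mul_mem' := by
    rintro x y ⟨Q, hQ, P, h⟩ ⟨Q', hQ', P', h'⟩
    exact ⟨Q * Q', S.mul_mem hQ hQ', P * P', by rw [map_mul, map_mul, ← h, ← h']; ring⟩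
  one_mem' := ⟨1, S.one_mem, 1, by simp⟩
  add_mem' := by
    rintro x y ⟨Q, hQ, P, h⟩ ⟨Q', hQ', P', h'⟩
    exact ⟨Q * Q', S.mul_mem hQ hQ', P * Q' + P' * Q, by
      rw [map_add, map_mul, map_mul, map_mul, ← h, ← h']; ring⟩
  zero_mem' := ⟨1, S.one_mem, 0, by simp⟩
  neg_mem' := by
    rintro x ⟨Q, hQ, P, h⟩
    exact ⟨Q, hQ, -P, by rw [map_neg, ← h]; ring⟩

theorem mem_fracSubring {f : R →+* C} {S : Submonoid R} {z : C} :
    z ∈ fracSubring f S ↔ ∃ Q ∈ S, ∃ P, z * f Q = f P := Iff.rfl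

theorem map_mem_fracSubring (f : R →+* C) (S : Submonoid R) (P : R) : f P ∈ fracSubring f S :=
  ⟨1, S.one_mem, P, by simp⟩

theorem fst_mem_fracSubring {f : R →+* C} {g : R →+* C'} {S : Submonoid R} {z : C × C'}
    (h : z ∈ fracSubring (f.prod g) S) : z.1 ∈ fracSubring f S := by
  obtain ⟨Q, hQ, P, h⟩ := h
  exact ⟨Q, hQ, P, congrArg Prod.fst h⟩

theorem inv_map_mem_fracSubring {K : Type*} [Field K] {f : R →+* K} {S : Submonoid R} {Q : R}
    (hQ : Q ∈ S) (h : f Q ≠ 0) : (f Q)⁻¹ ∈ fracSubring f S :=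
  ⟨Q, hQ, 1, by rw [inv_mul_cancel₀ h, map_one]⟩

/-- Pairs are invertible if the numerators of their second components are denominators. -/
theorem inv_mem_fracSubring {F K : Type*} [Field F] [Field K] {f : R →+* F} {g : R →+* K}
    {S : Submonoid R} {x : F} {c : K} (h : (x, c) ∈ fracSubring (f.prod g) S) (hx : x ≠ 0)
    (hc : c ≠ 0) (hS : ∀ P, ∀ Q ∈ S, c * g Q = g P → P ∈ S) :
    (x⁻¹, c⁻¹) ∈ fracSubring (f.prod g) S := by
  obtain ⟨Q, hQ, P, h⟩ := h
  have h₁ : x * f Q = f P := congrArg Prod.fst h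
  have h₂ : c * g Q = g P := congrArg Prod.snd h
  refine ⟨P, hS P Q hQ h₂, Q, Prod.ext ?_ ?_⟩
  · change x⁻¹ * f P = f Q
    rw [← h₁, inv_mul_cancel_left₀ hx]
  · change c⁻¹ * g P = g Q
    rw [← h₂, inv_mul_cancel_left₀ hc]

/-- A pair is determined by its first component. -/
theorem eq_zero_of_mem_fracSubring {F K : Type*} [Field F] [Field K] {f : R →+* F} {g : R →+* K}
    {S : Submonoid R} {c : K} (h : (0, c) ∈ fracSubring (f.prod g) S)
    (hf : Function.Injective f) (hg : ∀ Q ∈ S, g Q ≠ 0) : c = 0 := by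
  obtain ⟨Q, hQ, P, h⟩ := h
  have h₁ : 0 * f Q = f P := congrArg Prod.fst h
  have h₂ : c * g Q = g P := congrArg Prod.snd h
  rw [zero_mul, ← map_zero f] at h₁
  rw [← hf h₁, map_zero] at h₂
  exact (mul_eq_zero.1 h₂).resolve_right (hg Q hQ)

end FracSubring

/-! ### Existence and uniqueness of two-sided orbits -/

section Existence

variable {F : Type*} [Field F]

theorem MultiAt.eq_div {N : ℕ} {α β : F} {τ : ℤ → F} {n : ℤ} (H : MultiAt N α β τ n)
    (h : topCoeff N τ n ≠ 0) : τ (n + N + 3) = multiRHS N α β τ n / topCoeff N τ n := by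
  rw [eq_div_iff h, ← multiLHS_eq]
  exact H

theorem topCoeff_ne_zero {N : ℕ} {τ : ℤ → F} {n : ℤ}
    (h : ∀ j, n ≤ j → j ≤ n + N + 2 → τ j ≠ 0) : topCoeff N τ n ≠ 0 := by
  refine mul_ne_zero (pow_ne_zero _ (h _ (by omega) (by omega))) (Finset.prod_ne_zero_iff.2
    fun j hj => ?_)
  rw [Finset.mem_Icc] at hj
  exact h _ (by omega) (by omega)

/-- The first `m` steps of the forward recurrence, applied to the initial data `c`. -/
noncomputable def forwardSteps (N : ℕ) (α β : F) (c : ℤ → F) : ℕ → ℤ → F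
  | 0 => c
  | m + 1 => Function.update (forwardSteps N α β c m) ((m : ℤ) + N + 3)
      (multiRHS N α β (forwardSteps N α β c m) m / topCoeff N (forwardSteps N α β c m) m)

theorem forwardSteps_eq (N : ℕ) (α β : F) (c : ℤ → F) {m m' : ℕ} (h : m ≤ m') {j : ℤ}
    (hj : j < m + N + 3) : forwardSteps N α β c m' j = forwardSteps N α β c m j := by
  induction m', h using Nat.le_induction with
  | base => rfl
  | succ k hk ih =>
    rw [forwardSteps, Function.update_of_ne (by omega), ih]

/-- The predicate `P` is an invariant strong enough to be propagated by the recurrence; nonvanishing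
alone is not. -/
theorem exists_forward {N : ℕ} (hN : 2 ≤ N) (α β : F) (P : F → Prop) (hP₀ : ∀ x, P x → x ≠ 0)
    (hP : ∀ (τ : ℤ → F) (n : ℤ), (∀ j, n ≤ j → j ≤ n + N + 2 → P (τ j)) →
      P (multiRHS N α β τ n / topCoeff N τ n))
    (c : ℤ → F) (hc : ∀ j : ℤ, 0 ≤ j → j ≤ N + 2 → P (c j)) :
    ∃ τ : ℤ → F, (∀ j : ℤ, 0 ≤ j → j ≤ N + 2 → τ j = c j) ∧
      (∀ n : ℤ, 0 ≤ n → MultiAt N α β τ n) ∧ ∀ j : ℤ, 0 ≤ j → P (τ j) := by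
  set f := forwardSteps N α β c with hf
  have hPf : ∀ (m : ℕ) (j : ℤ), 0 ≤ j → j < m + N + 3 → P (f m j) := by
    intro m
    induction m with
    | zero => exact fun j h₁ h₂ => hc j h₁ (by omega)
    | succ m ih =>
      intro j h₁ h₂
      by_cases hj : j = m + N + 3
      · rw [hf, forwardSteps, hj, Function.update_self]
        exact hP _ _ fun i h₁ h₂ => ih i (by omega) (by omega)
      · rw [hf, forwardSteps, Function.update_of_ne hj]
        exact ih j h₁ (by omega)
  have heq : ∀ (m : ℕ) (j : ℤ), j < m + N + 3 → f (j + 1).toNat j = f m j := by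
    intro m j hj
    rcases le_total m (j + 1).toNat with h | h
    · exact forwardSteps_eq N α β c h hj
    · exact (forwardSteps_eq N α β c h (by omega)).symm
  -- The value at `j` is already final after `j + 1` steps, so the diagonal is the limit of the
  -- finite stages.
  refine ⟨fun j => f (j + 1).toNat j, fun j h₁ h₂ => ?_, fun n hn => ?_, fun j hj => ?_⟩
  · exact heq 0 j (by omega)
  · lift n to ℕ using hn
    refine MultiAt.congr hN (τ := f (n + 1)) ?_ fun j h₁ h₂ => (heq (n + 1) j (by omega)).symm
    have h₀ : ∀ j, (n : ℤ) ≤ j → j ≤ n + N + 2 → f (n + 1) j = f n j := fun j h₁ h₂ =>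
      forwardSteps_eq N α β c (Nat.le_succ n) (by omega)
    unfold MultiAt
    rw [multiLHS_eq, topCoeff_congr h₀, multiRHS_congr hN h₀]
    have : f (n + 1) (n + N + 3) = multiRHS N α β (f n) n / topCoeff N (f n) n := by
      rw [hf, forwardSteps, Function.update_self]
    rw [this, div_mul_cancel₀]
    exact topCoeff_ne_zero fun j h₁ h₂ => hP₀ _ (hPf n j (by omega) (by omega))
  · exact hPf _ j hj (by omega)

theorem exists_orbit {N : ℕ} (hN : 2 ≤ N) (α β : F) (P : F → Prop) (hP₀ : ∀ x, P x → x ≠ 0)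
    (hP : ∀ (τ : ℤ → F) (n : ℤ), (∀ j, n ≤ j → j ≤ n + N + 2 → P (τ j)) →
      P (multiRHS N α β τ n / topCoeff N τ n))
    (c : ℤ → F) (hc : ∀ j : ℤ, 0 ≤ j → j ≤ N + 2 → P (c j)) :
    ∃ τ : ℤ → F, (∀ j : ℤ, 0 ≤ j → j ≤ N + 2 → τ j = c j) ∧
      (∀ n : ℤ, MultiAt N α β τ n) ∧ ∀ j : ℤ, P (τ j) := by
  obtain ⟨τ, h₁, h₂, h₃⟩ := exists_forward hN α β P hP₀ hP c hc
  obtain ⟨σ, k₁, k₂, k₃⟩ := exists_forward hN α β P hP₀ hP (fun j => c (N + 2 - j))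
    fun j _ _ => hc _ (by omega) (by omega)
  have e₁ : ∀ j : ℤ, 0 ≤ j → (if 0 ≤ j then τ j else σ (N + 2 - j)) = τ j := fun j hj => if_pos hj
  have e₂ : ∀ j : ℤ, j ≤ N + 2 → (if 0 ≤ j then τ j else σ (N + 2 - j)) = σ (N + 2 - j) := by
    intro j hj
    split_ifs with h
    · rw [h₁ j h hj, k₁ _ (by omega) (by omega), sub_sub_cancel]
    · rfl
  -- The two halves agree on `0, …, N + 2`, and every window `n, …, n + N + 3` lies in `j ≥ 0` or in
  -- `j ≤ N + 2`.
  refine ⟨fun j => if 0 ≤ j then τ j else σ (N + 2 - j), fun j hj hj' => ?_, fun n => ?_,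
    fun j => ?_⟩
  · exact (e₁ j hj).trans (h₁ j hj hj')
  · rcases le_or_gt 0 n with hn | hn
    · exact (h₂ n hn).congr hN fun j _ _ => (e₁ j (by omega)).symm
    · have := (k₂ (-1 - n) (by omega)).reverse hN (N + 2)
      rw [show (N : ℤ) + 2 - (-1 - n) - N - 3 = n by ring] at this
      exact this.congr hN fun j _ _ => (e₂ j (by omega)).symm
  · rcases le_or_gt 0 j with hj | hj
    · exact (congrArg P (e₁ j hj)).mpr (h₃ j hj)
    · exact (congrArg P (e₂ j (by omega))).mpr (k₃ _ (by omega))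

theorem orbit_unique_forward {N : ℕ} (hN : 2 ≤ N) {α β : F} {τ σ : ℤ → F} (h₀ : ∀ j, τ j ≠ 0)
    (hτ : ∀ n, MultiAt N α β τ n) (hσ : ∀ n, MultiAt N α β σ n)
    (h : ∀ j : ℤ, 0 ≤ j → j ≤ N + 2 → σ j = τ j) : ∀ j : ℤ, 0 ≤ j → σ j = τ j := by
  have : ∀ (m : ℕ) (j : ℤ), 0 ≤ j → j < m + N + 3 → σ j = τ j := by
    intro m
    induction m with
    | zero => exact fun j h₁ h₂ => h j h₁ (by omega)
    | succ m ih =>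
      intro j h₁ h₂
      by_cases hj : j = m + N + 3
      · have e : ∀ j, (m : ℤ) ≤ j → j ≤ m + N + 2 → σ j = τ j := fun j _ _ =>
          ih j (by omega) (by omega)
        have ht : topCoeff N τ m ≠ 0 := topCoeff_ne_zero fun j _ _ => h₀ j
        rw [hj, (hτ m).eq_div ht, (hσ m).eq_div (by rwa [topCoeff_congr e]), topCoeff_congr e,
          multiRHS_congr hN e]
      · exact ih j h₁ (by omega)
  exact fun j hj => this j.toNat j hj (by omega)

theorem orbit_unique {N : ℕ} (hN : 2 ≤ N) {α β : F} {τ σ : ℤ → F} (h₀ : ∀ j, τ j ≠ 0)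
    (hτ : ∀ n, MultiAt N α β τ n) (hσ : ∀ n, MultiAt N α β σ n)
    (h : ∀ j : ℤ, 0 ≤ j → j ≤ N + 2 → σ j = τ j) : σ = τ := by
  funext j
  rcases le_or_gt 0 j with hj | hj
  · exact orbit_unique_forward hN h₀ hτ hσ h j hj
  · have := orbit_unique_forward hN (τ := fun j => τ (N + 2 - j)) (fun j => h₀ _) (reverse_orbit hτ hN)
      (reverse_orbit hσ hN) (fun j _ _ => h _ (by omega) (by omega)) (N + 2 - j) (by omega)
    simpa using this

end Existence

/-! ### Two explicit orbits -/

section SpecialSolutions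

theorem multiAt_one {N : ℕ} (hN : 2 ≤ N) (n : ℤ) :
    MultiAt N ((N : ℚ) + 1) 0 (fun _ => 1) n := by
  have h : ((N - 1 : ℕ) : ℚ) = N - 1 := by
    rw [Nat.cast_sub (by omega)]
    simp
  simp [MultiAt, multiLHS, multiRHS, h]

/-- The arithmetic progressions with difference one solve the multilinear relation for a
special choice of the parameters. -/
theorem multiAt_linear {K : Type*} [Field K] [CharZero K] {N : ℕ} (hN : 2 ≤ N) (x : K)
    (hx : ∀ j : ℤ, (j : K) + x ≠ 0) (n : ℤ) :
    MultiAt N (-(N + 1) / (N - 1) : K) (-(N * (N + 1)) / (N - 1)) (fun j => j + x) n := by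
  have h1 : (N : K) - 1 ≠ 0 := by
    rw [sub_ne_zero]
    exact_mod_cast (by omega : N ≠ 1)
  have key := multiLHS_sub_multiRHS hN (-(N + 1) / (N - 1) : K) (-(N * (N + 1)) / (N - 1))
    (fun j => j + x) (fun j => (j + x)⁻¹) n fun j _ => mul_inv_cancel₀ (hx _)
  -- With `t = n + j + x`, the summand is `1 - 2 / ((t + 1) (t + 2))`, so the sum telescopes.
  have hs : ∀ M : ℕ, ∑ j ∈ Finset.Icc 0 M, (((n + j + 3 : ℤ) : K) + x) * (((n + j : ℤ) : K) + x) *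
      ((((n + j + 2 : ℤ) : K) + x)⁻¹ * (((n + j + 1 : ℤ) : K) + x)⁻¹) =
      M + 1 - 2 * ((((n + 1 : ℤ) : K) + x)⁻¹ - (((n + M + 2 : ℤ) : K) + x)⁻¹) := by
    intro M
    induction M with
    | zero =>
      have a1 := hx (n + 1)
      have a2 := hx (n + 2)
      simp only [Finset.Icc_self, Finset.sum_singleton]
      push_cast at *
      simp only [add_zero]
      field_simp
      ring
    | succ M ih =>
      rw [Finset.sum_Icc_succ_top (by omega), ih]
      have a1 := hx (n + M + 2)
      have a2 := hx (n + M + 3)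
      have a3 := hx (n + 1)
      push_cast at *
      have e2 : (n : K) + (M + 1) + 1 + x = n + M + 2 + x := by ring
      have e3 : (n : K) + (M + 1) + 2 + x = n + M + 3 + x := by ring
      rw [e2, e3]
      field_simp
      ring
  unfold MultiAt
  rw [← sub_eq_zero, key]
  refine mul_eq_zero_of_right _ ?_
  simp only [hs]
  have a1 := hx (n + 1)
  have a2 := hx (n + N + 2)
  push_cast at *
  field_simp
  ring

end SpecialSolutions

/-! ### The generic orbit and its specializations -/

section Generic

open MvPolynomial

/-- The polynomial ring in the two parameters and the `N + 3` initial data. -/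
abbrev GenericRing (N : ℕ) : Type := MvPolynomial (Fin 2 ⊕ Fin (N + 3)) ℤ

/-- The specialization of the parameters to `a`, `b` and of the initial data to
`c 0, …, c (N + 2)`. -/
noncomputable def specialize {C : Type*} [CommRing C] (N : ℕ) (a b : C) (c : ℤ → C) :
    GenericRing N →+* C :=
  eval₂Hom (Int.castRingHom C) (Sum.elim ![a, b] fun i => c (i : ℕ))

section Specialize

variable {C : Type*} [CommRing C] (N : ℕ) (a b : C) (c : ℤ → C)

@[simp] theorem specialize_alpha : specialize N a b c (X (Sum.inl 0)) = a := by
  simp [specialize]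

@[simp] theorem specialize_beta : specialize N a b c (X (Sum.inl 1)) = b := by
  simp [specialize]

@[simp] theorem specialize_tau (i : Fin (N + 3)) :
    specialize N a b c (X (Sum.inr i)) = c (i : ℕ) := by
  simp [specialize]

variable {N a b c}

theorem specialize_mem {U : Subring C} (ha : a ∈ U) (hb : b ∈ U)
    (hc : ∀ j : ℤ, 0 ≤ j → j ≤ N + 2 → c j ∈ U) (P : GenericRing N) :
    specialize N a b c P ∈ U := by
  induction P using MvPolynomial.induction_on with
  | C r => simp [specialize]
  | add p q hp hq => rw [map_add]; exact U.add_mem hp hq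
  | mul_X p i hp =>
    rw [map_mul]
    refine U.mul_mem hp ?_
    rcases i with i | i
    · fin_cases i
      · simpa using ha
      · simpa using hb
    · simpa using hc i (by omega) (by omega)

end Specialize

variable {N : ℕ}

/-- The embedding of the polynomial ring into its field of fractions, together with a
specialization. -/
noncomputable abbrev pairing {C : Type*} [CommRing C] (a b : C) (c : ℤ → C) :
    GenericRing N →+* RatField N × C :=
  (algebraMap (GenericRing N) (RatField N)).prod (specialize N a b c)

theorem algebraMap_injective : Function.Injective (algebraMap (GenericRing N) (RatField N)) :=
  IsFractionRing.injective _ _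

theorem alpha_pair_mem {C : Type*} [CommRing C] (a b : C) (c : ℤ → C)
    (S : Submonoid (GenericRing N)) : (alphaVar N, a) ∈ fracSubring (pairing a b c) S := by
  have := map_mem_fracSubring (pairing (N := N) a b c) S (X (Sum.inl 0))
  simpa [pairing, alphaVar] using this

theorem beta_pair_mem {C : Type*} [CommRing C] (a b : C) (c : ℤ → C)
    (S : Submonoid (GenericRing N)) : (betaVar N, b) ∈ fracSubring (pairing a b c) S := by
  have := map_mem_fracSubring (pairing (N := N) a b c) S (X (Sum.inl 1))
  simpa [pairing, betaVar] using this

theorem tau_pair_mem {C : Type*} [CommRing C] (a b : C) (c : ℤ → C)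
    (S : Submonoid (GenericRing N)) (i : Fin (N + 3)) :
    (tauVar N i, c (i : ℕ)) ∈ fracSubring (pairing a b c) S := by
  have := map_mem_fracSubring (pairing (N := N) a b c) S (X (Sum.inr i))
  simpa [pairing, tauVar] using this

theorem IsGenericOrbit.apply {τ : ℤ → RatField N} (h : IsGenericOrbit N τ) {j : ℤ} (h₀ : 0 ≤ j)
    (h₁ : j ≤ N + 2) : ∃ i : Fin (N + 3), ((i : ℕ) : ℤ) = j ∧ τ j = tauVar N i := by
  lift j to ℕ using h₀
  exact ⟨⟨j, by omega⟩, rfl, h.1 ⟨j, by omega⟩⟩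

theorem IsGenericOrbit.initial_mem {C : Type*} [CommRing C] {τ : ℤ → RatField N}
    (h : IsGenericOrbit N τ) (a b : C) (c : ℤ → C) (S : Submonoid (GenericRing N)) {j : ℤ}
    (h₀ : 0 ≤ j) (h₁ : j ≤ N + 2) : (τ j, c j) ∈ fracSubring (pairing a b c) S := by
  obtain ⟨i, rfl, hi⟩ := h.apply h₀ h₁
  rw [hi]
  exact tau_pair_mem a b c S i

/-- The polynomials that do not vanish under a homomorphism to a field. -/
def nonvanishing {R k : Type*} [CommRing R] [Field k] (f : R →+* k) : Submonoid R :=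
  (nonZeroDivisors k).comap f

theorem mem_nonvanishing {R k : Type*} [CommRing R] [Field k] {f : R →+* k} {Q : R} :
    Q ∈ nonvanishing f ↔ f Q ≠ 0 := by
  rw [nonvanishing, Submonoid.mem_comap, mem_nonZeroDivisors_iff_ne_zero]

/-- The invariant is that a term is regular, with value `1`, at the point `α = N + 1`, `β = 0`, all
data `1`. Such an element is nonzero with inverse of the same kind, and the all-ones solution makes
the recurrence preserve this. -/
theorem exists_genericOrbit (hN : 2 ≤ N) :
    ∃ τ, IsGenericOrbit N τ ∧ ∀ j, τ j ≠ 0 := by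
  set φ := specialize N ((N : ℚ) + 1) 0 (fun _ => 1) with hφ
  set T := fracSubring (pairing (N := N) ((N : ℚ) + 1) 0 (fun _ => 1)) (nonvanishing φ)
  have hne : ∀ x, (x, (1 : ℚ)) ∈ T → x ≠ 0 := by
    rintro _ hx rfl
    exact one_ne_zero (eq_zero_of_mem_fracSubring hx algebraMap_injective
      fun Q hQ => mem_nonvanishing.1 hQ)
  have hinv : ∀ x, (x, (1 : ℚ)) ∈ T → (x⁻¹, (1 : ℚ)) ∈ T := by
    intro x hx
    have := inv_mem_fracSubring hx (hne x hx) one_ne_zero fun P Q hQ h => by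
      rw [one_mul] at h
      rw [mem_nonvanishing] at *
      rwa [← h]
    rwa [inv_one] at this
  have hstep : ∀ (τ : ℤ → RatField N) (n : ℤ),
      (∀ j, n ≤ j → j ≤ n + N + 2 → (τ j, (1 : ℚ)) ∈ T) →
      (multiRHS N (alphaVar N) (betaVar N) τ n / topCoeff N τ n, (1 : ℚ)) ∈ T := by
    intro τ n h
    have h₁ : (multiRHS N (alphaVar N) (betaVar N) τ n, (1 : ℚ)) ∈ T := by
      have := multiRHS_mem hN T (alpha_pair_mem _ _ _ _) (beta_pair_mem _ _ _ _)
        (τ := fun j => (τ j, (1 : ℚ))) h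
      rwa [multiRHS_pair, ← show _ = _ from multiAt_one hN n, multiLHS_eq, topCoeff_one,
        mul_one] at this
    have h₂ : (topCoeff N τ n, (1 : ℚ)) ∈ T := by
      have := topCoeff_mem T (τ := fun j => (τ j, (1 : ℚ))) h
      rwa [topCoeff_pair, topCoeff_one] at this
    have := T.mul_mem h₁ (hinv _ h₂)
    rwa [Prod.mk_mul_mk, mul_one, ← div_eq_mul_inv] at this
  obtain ⟨τ, h₁, h₂, h₃⟩ := exists_orbit hN (alphaVar N) (betaVar N)
    (fun x => (x, (1 : ℚ)) ∈ T) hne hstep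
    (fun j => if h : j.toNat < N + 3 then tauVar N ⟨j.toNat, h⟩ else 1) (fun j h₀ h₁ => by
      rw [dif_pos (by omega)]
      exact tau_pair_mem _ _ (fun _ => 1) _ _)
  refine ⟨τ, ⟨fun i => ?_, h₂⟩, fun j => hne _ (h₃ j)⟩
  rw [h₁ _ (by omega) (by omega), dif_pos (by simp)]
  congr

/-- Terms of the generic orbit that are fractions with admissible denominators specialize to
the terms of any nowhere vanishing orbit. -/
theorem IsGenericOrbit.transfer (hN : 2 ≤ N) {τ : ℤ → RatField N} (h : IsGenericOrbit N τ)
    {F : Type*} [Field F] {a b : F} {t : ℤ → F} (ht : ∀ n, MultiAt N a b t n)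
    (h₀ : ∀ j, t j ≠ 0) {S : Submonoid (GenericRing N)}
    (hS : ∀ Q ∈ S, specialize N a b t Q ≠ 0) (m : ℕ)
    (hm : ∀ j : ℤ, 0 ≤ j → j ≤ m → τ j ∈ fracSubring (algebraMap _ (RatField N)) S) :
    ∀ j : ℤ, 0 ≤ j → j ≤ m → (τ j, t j) ∈ fracSubring (pairing a b t) S := by
  induction m with
  | zero =>
    intro j h₁ h₂
    exact h.initial_mem a b t S h₁ (by omega)
  | succ m ih =>
    have ih := ih fun j h₁ h₂ => hm j h₁ (by omega)
    intro j h₁ h₂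
    rcases le_or_gt j m with h₃ | h₃
    · exact ih j h₁ h₃
    rcases le_or_gt j (N + 2) with h₄ | h₄
    · exact h.initial_mem a b t S h₁ h₄
    obtain ⟨Q, hQ, P, e⟩ := hm j h₁ h₂
    set φ := specialize N a b t with hφ
    -- The specialized fraction is a candidate for `t j`. The relation holds in the first component,
    -- hence in the second, and there it determines `t j`.
    have hc : (τ j, φ P / φ Q) ∈ fracSubring (pairing a b t) S :=
      ⟨Q, hQ, P, Prod.ext e (div_mul_cancel₀ _ (hS Q hQ))⟩
    obtain ⟨n, rfl⟩ : ∃ n, j = n + N + 3 := ⟨j - N - 3, by ring⟩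
    set T := fracSubring (pairing (N := N) a b t) S
    have hw : ∀ i, n ≤ i → i ≤ n + N + 2 → (τ i, t i) ∈ T := fun i _ _ =>
      ih i (by omega) (by omega)
    have hR := multiRHS_mem hN T (alpha_pair_mem a b t S) (beta_pair_mem a b t S)
      (τ := fun j => (τ j, t j)) hw
    have hD := topCoeff_mem T (τ := fun j => (τ j, t j)) hw
    have hd := T.sub_mem (T.mul_mem hc hD) hR
    have e₁ : τ (n + N + 3) * topCoeff N τ n - multiRHS N (alphaVar N) (betaVar N) τ n = 0 := by
      rw [← multiLHS_eq, sub_eq_zero]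
      exact h.2 n
    rw [topCoeff_pair, multiRHS_pair, Prod.mk_mul_mk, Prod.mk_sub_mk, e₁] at hd
    have e₃ := eq_zero_of_mem_fracSubring hd algebraMap_injective hS
    have hD₀ : topCoeff N t n ≠ 0 := topCoeff_ne_zero fun j _ _ => h₀ j
    have e₄ : t (n + N + 3) = φ P / φ Q := by
      rw [(ht n).eq_div hD₀, div_eq_iff hD₀]
      exact (sub_eq_zero.1 e₃).symm
    rwa [e₄]

end Generic

/-! ### The Laurent property -/

section StrongLaurent

open MvPolynomial

theorem comp_specialize {C C' : Type*} [CommRing C] [CommRing C'] (f : C →+* C') (N : ℕ)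
    (a b : C) (c : ℤ → C) :
    f.comp (specialize N a b c) = specialize N (f a) (f b) (fun j => f (c j)) := by
  refine MvPolynomial.ringHom_ext (fun r => by simp [specialize]) fun i => ?_
  rcases i with i | i
  · fin_cases i <;> simp
  · simp

variable {N : ℕ}

/-- The polynomials that do not vanish where the initial data are
`-(N + 2), …, -1, 0` and the parameters are those of the linear solution. -/
noncomputable def centerDenominators (N : ℕ) : Submonoid (GenericRing N) :=
  nonvanishing (specialize N (-(N + 1) / (N - 1) : ℚ) (-(N * (N + 1)) / (N - 1))
    (fun j => ((j - (N + 2) : ℤ) : ℚ)))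

/-- At the centre the orbit follows `j - (N + 2)`, whose only zero is at `j = N + 2`. Confinement
carries regularity across this zero for `N + 3` terms, a full window from which to restart. -/
theorem IsGenericOrbit.confined (hN : 2 ≤ N) {τ : ℤ → RatField N} (h : IsGenericOrbit N τ)
    (h₀ : ∀ j, τ j ≠ 0) {j : ℤ} (hj₀ : 0 ≤ j) (hj₁ : j ≤ 2 * N + 5) :
    τ j ∈ fracSubring (algebraMap _ (RatField N)) (centerDenominators N) ∧
      (j ≠ N + 2 → (τ j)⁻¹ ∈ fracSubring (algebraMap _ (RatField N)) (centerDenominators N)) := by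
  -- The progression is shifted by an indeterminate so that no term vanishes and `confinement`
  -- applies; setting the indeterminate to `0` recovers the centre.
  set K := FractionRing (Polynomial ℚ) with hK
  have hinj : Function.Injective (algebraMap (Polynomial ℚ) K) := IsFractionRing.injective _ _
  have : CharZero K := charZero_of_injective_algebraMap hinj
  set x : K := algebraMap (Polynomial ℚ) K Polynomial.X with hx
  have hne : ∀ i : ℤ, (i : K) + x ≠ 0 := fun i hi => by
    have h₁ : algebraMap (Polynomial ℚ) K (Polynomial.X + Polynomial.C (i : ℚ)) = 0 := by
      rw [map_add, ← hx, ← hi, add_comm]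
      simp
    rw [map_eq_zero_iff _ hinj] at h₁
    exact Polynomial.X_add_C_ne_zero _ h₁
  set a : ℚ := -(N + 1) / (N - 1) with ha
  set b : ℚ := -(N * (N + 1)) / (N - 1) with hb
  set evP := specialize N (Polynomial.C a) (Polynomial.C b)
    (fun j => Polynomial.C ((j - (N + 2) : ℤ) : ℚ) + Polynomial.X) with hevP
  have hC : ∀ q : ℚ, algebraMap (Polynomial ℚ) K (Polynomial.C q) = (q : K) := fun q =>
    map_ratCast ((algebraMap (Polynomial ℚ) K).comp Polynomial.C) q
  set cK : ℤ → K := fun j => ((j - (N + 2) : ℤ) : K) + x with hcK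
  have hev : specialize N (a : K) (b : K) cK = (algebraMap (Polynomial ℚ) K).comp evP := by
    rw [hevP, comp_specialize, hC, hC]
    congr 1
    funext j
    rw [map_add, hC, ← hx, Rat.cast_intCast]
  have hev₀ : specialize N a b (fun j => ((j - (N + 2) : ℤ) : ℚ)) =
      (Polynomial.evalRingHom 0).comp evP := by
    rw [hevP, comp_specialize]
    simp
  set S := centerDenominators N with hS
  have memS : ∀ Q, Q ∈ S ↔ (evP Q).eval 0 ≠ 0 := fun Q => by
    rw [hS, centerDenominators, mem_nonvanishing, ← ha, ← hb, hev₀]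
    rfl
  set T := fracSubring (pairing (N := N) (a : K) (b : K) cK) S with hT
  -- The second component `i + x` takes the value `i ≠ 0` at the centre, so the numerator is itself
  -- an admissible denominator.
  have hι : ∀ i : ℤ, i ≠ 0 → (τ (i + (N + 2)), (i : K) + x) ∈ T →
      ((τ (i + (N + 2)))⁻¹, ((i : K) + x)⁻¹) ∈ T := by
    intro i hi hT
    refine inv_mem_fracSubring hT (h₀ _) (hne i) fun P Q hQ e => ?_
    rw [hev] at e
    have e' : (Polynomial.C (i : ℚ) + Polynomial.X) * evP Q = evP P := by
      apply hinj
      rw [map_mul, map_add, hC, Rat.cast_intCast]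
      exact e
    rw [memS] at hQ ⊢
    rw [← e']
    simpa using ⟨hi, hQ⟩
  have hlin : ∀ n, MultiAt N (a : K) (b : K) (fun i => (i : K) + x) n := fun n => by
    have := multiAt_linear hN x hne n
    rw [ha, hb]
    push_cast
    exact this
  have hconf := confinement hN T (α := (alphaVar N, (a : K))) (β := (betaVar N, (b : K)))
    (alpha_pair_mem _ _ _ _) (beta_pair_mem _ _ _ _)
    (z := fun i => (τ (i + (N + 2)), (i : K) + x))
    (ι := fun i => ((τ (i + (N + 2)))⁻¹, ((i : K) + x)⁻¹))
    (fun i => Prod.ext (mul_inv_cancel₀ (h₀ _)) (mul_inv_cancel₀ (hne i)))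
    (fun n => multiAt_pair (MultiAt.shift _ (h.2 _)) (hlin n))
    (fun i h₁ h₂ => by
      have := h.initial_mem (a : K) (b : K) cK S (j := i + (N + 2)) (by omega) (by omega)
      simp only [hcK, add_sub_cancel_right] at this
      exact this)
    hι (j - (N + 2)) (by omega) (by omega)
  have hfin := fst_mem_fracSubring hconf
  refine ⟨?_, fun hj => ?_⟩
  · simpa using hfin
  · have := fst_mem_fracSubring (hι (j - (N + 2)) (by omega) hconf)
    simpa using this

/-- The monomials in the initial data other than the last one. -/
noncomputable def innerMonomials (N : ℕ) : Submonoid (GenericRing N) :=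
  Submonoid.closure {P | ∃ i : Fin (N + 3), (i : ℕ) < N + 2 ∧ P = X (Sum.inr i)}

/-- The monomials in the initial data. -/
noncomputable def allMonomials (N : ℕ) : Submonoid (GenericRing N) :=
  Submonoid.closure (Set.range fun i : Fin (N + 3) => X (Sum.inr i))

theorem specialize_innerMonomials {F : Type*} [Field F] {a b : F} {t : ℤ → F}
    (h₀ : ∀ j, t j ≠ 0) {U : Subring F} (hU : ∀ j : ℤ, 0 ≤ j → j ≤ N + 1 → (t j)⁻¹ ∈ U)
    {Q : GenericRing N} (hQ : Q ∈ innerMonomials N) :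
    specialize N a b t Q ≠ 0 ∧ (specialize N a b t Q)⁻¹ ∈ U := by
  induction hQ using Submonoid.closure_induction with
  | mem P hP =>
    obtain ⟨i, hi, rfl⟩ := hP
    rw [specialize_tau]
    exact ⟨h₀ _, hU _ (by omega) (by omega)⟩
  | one => simp
  | mul P Q _ _ hP hQ =>
    rw [map_mul, mul_inv]
    exact ⟨mul_ne_zero hP.1 hQ.1, U.mul_mem hP.2 hQ.2⟩

/-- If a term of the generic orbit is a polynomial in the parameters, the initial data, and the
inverses of all but the last initial datum, then so is the corresponding term of every other
orbit. -/
theorem IsGenericOrbit.mem_of_mem (hN : 2 ≤ N) {τ : ℤ → RatField N} (h : IsGenericOrbit N τ)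
    {F : Type*} [Field F] {a b : F} {t : ℤ → F} (ht : ∀ n, MultiAt N a b t n)
    (h₀ : ∀ j, t j ≠ 0) (m : ℕ)
    (hm : ∀ j : ℤ, 0 ≤ j → j ≤ m →
      τ j ∈ fracSubring (algebraMap _ (RatField N)) (innerMonomials N))
    {U : Subring F} (ha : a ∈ U) (hb : b ∈ U) (hU : ∀ j : ℤ, 0 ≤ j → j ≤ N + 2 → t j ∈ U)
    (hU' : ∀ j : ℤ, 0 ≤ j → j ≤ N + 1 → (t j)⁻¹ ∈ U) : t m ∈ U := by
  obtain ⟨Q, hQ, P, e⟩ := h.transfer hN ht h₀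
    (fun Q hQ => (specialize_innerMonomials h₀ hU' hQ).1) m hm m (by omega) le_rfl
  have e' : t m * specialize N a b t Q = specialize N a b t P := congrArg Prod.snd e
  have hQ' := specialize_innerMonomials (a := a) (b := b) h₀ hU' hQ
  rw [← eq_mul_inv_iff_mul_eq₀ hQ'.1] at e'
  rw [e']
  exact U.mul_mem (specialize_mem ha hb hU P) hQ'.2

theorem last_prime (N : ℕ) : Prime (X (Sum.inr (Fin.last (N + 2))) : GenericRing N) := X_prime

theorem exists_innerMonomial_mul_pow {Q : GenericRing N} (hQ : Q ∈ allMonomials N) :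
    ∃ M ∈ innerMonomials N, ∃ r : ℕ, Q = M * X (Sum.inr (Fin.last (N + 2))) ^ r := by
  induction hQ using Submonoid.closure_induction with
  | mem P hP =>
    obtain ⟨i, rfl⟩ := hP
    rcases (Nat.lt_succ_iff.1 i.2).lt_or_eq with hi | hi
    · exact ⟨_, Submonoid.subset_closure ⟨i, hi, rfl⟩, 0, by simp⟩
    · exact ⟨1, Submonoid.one_mem _, 1, by
        rw [show i = Fin.last (N + 2) from Fin.ext hi]; simp⟩
  | one => exact ⟨1, Submonoid.one_mem _, 0, by simp⟩
  | mul P Q _ _ hP hQ =>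
    obtain ⟨M, hM, r, rfl⟩ := hP
    obtain ⟨M', hM', r', rfl⟩ := hQ
    exact ⟨M * M', Submonoid.mul_mem _ hM hM', r + r', by ring⟩

theorem not_last_dvd {Q : GenericRing N} (hQ : Q ∈ centerDenominators N) :
    ¬ X (Sum.inr (Fin.last (N + 2))) ∣ Q := by
  rintro ⟨P, rfl⟩
  rw [centerDenominators, mem_nonvanishing] at hQ
  exact hQ (by simp)

/-- A Laurent polynomial that is regular at a point where the last initial datum vanishes
is polynomial in the latter. -/
theorem mem_inner_of_mem_all {x : RatField N}
    (h₁ : x ∈ fracSubring (algebraMap _ (RatField N)) (allMonomials N))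
    (h₂ : x ∈ fracSubring (algebraMap _ (RatField N)) (centerDenominators N)) :
    x ∈ fracSubring (algebraMap _ (RatField N)) (innerMonomials N) := by
  obtain ⟨Q, hQ, P, e⟩ := h₁
  obtain ⟨Q', hQ', P', e'⟩ := h₂
  obtain ⟨M, hM, r, rfl⟩ := exists_innerMonomial_mul_pow hQ
  set ε : GenericRing N := X (Sum.inr (Fin.last (N + 2))) with hε
  -- Cross-multiplying the two fractions for `x` puts the power of the last datum on one side; it is
  -- prime to `Q'`, so it divides `P`.
  have hd : ε ^ r ∣ Q' * P := ⟨P' * M, algebraMap_injective (by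
    rw [map_mul, map_mul, map_mul, ← e, ← e', map_mul]; ring)⟩
  obtain ⟨P'', rfl⟩ := (last_prime N).pow_dvd_of_dvd_mul_left r (not_last_dvd hQ') hd
  refine ⟨M, hM, P'', ?_⟩
  have hne : algebraMap (GenericRing N) (RatField N) (ε ^ r) ≠ 0 := by
    rw [map_ne_zero_iff _ algebraMap_injective]
    exact pow_ne_zero _ (last_prime N).ne_zero
  rw [map_mul, map_mul] at e
  apply mul_right_cancel₀ hne
  rw [mul_assoc, e, mul_comm]

/-- Keeping the last datum out of the denominators is what makes the induction close: after a shift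
by one, that datum is `τ_{N+3}`, which is not a unit of the Laurent ring. -/
theorem IsGenericOrbit.mem_inner (hN : 2 ≤ N) {τ : ℤ → RatField N} (h : IsGenericOrbit N τ)
    (h₀ : ∀ j, τ j ≠ 0) (m : ℕ) : ∀ j : ℤ, 0 ≤ j → j ≤ m →
      τ j ∈ fracSubring (algebraMap _ (RatField N)) (innerMonomials N) := by
  have hinit : ∀ S : Submonoid (GenericRing N), ∀ j : ℤ, 0 ≤ j → j ≤ N + 2 →
      τ j ∈ fracSubring (algebraMap _ (RatField N)) S := fun S j h₁ h₂ => by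
    obtain ⟨i, -, hi⟩ := h.apply h₁ h₂
    rw [hi]
    exact map_mem_fracSubring _ _ _
  have hα : ∀ S : Submonoid (GenericRing N),
      alphaVar N ∈ fracSubring (algebraMap _ (RatField N)) S := fun S => map_mem_fracSubring _ _ _
  have hβ : ∀ S : Submonoid (GenericRing N),
      betaVar N ∈ fracSubring (algebraMap _ (RatField N)) S := fun S => map_mem_fracSubring _ _ _
  have hinv : ∀ j : ℤ, 0 ≤ j → j ≤ N + 2 →
      (τ j)⁻¹ ∈ fracSubring (algebraMap _ (RatField N)) (allMonomials N) := fun j h₁ h₂ => by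
    have hj := h₀ j
    obtain ⟨i, -, hi⟩ := h.apply h₁ h₂
    rw [hi] at hj ⊢
    exact inv_map_mem_fracSubring (Submonoid.subset_closure ⟨i, rfl⟩) hj
  induction m with
  | zero => exact fun j h₁ h₂ => hinit _ j h₁ (by omega)
  | succ m ih =>
    intro j h₁ h₂
    rcases le_or_gt j m with h₃ | h₃
    · exact ih j h₁ h₃
    rcases le_or_gt j (N + 2) with h₄ | h₄
    · exact hinit _ j h₁ h₄
    obtain rfl : j = m + 1 := by push_cast at h₂; omega
    refine mem_inner_of_mem_all ?_ ?_
    -- Laurentness: `τ_{m+1}` is term `m` of the orbit started at `τ_1`.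
    · refine h.mem_of_mem hN (t := fun j => τ (j + 1)) (fun n => MultiAt.shift 1 (h.2 _))
        (fun j => h₀ _) m ih (hα _) (hβ _) (fun j k₁ k₂ => ?_) fun j k₁ k₂ =>
          hinv _ (by omega) (by omega)
      rcases k₂.lt_or_eq with k₃ | rfl
      · exact hinit _ _ (by omega) (by omega)
      · have := next_mem hN _ (hα (allMonomials N)) (hβ _)
          (fun j => mul_inv_cancel₀ (h₀ j)) (h.2 0) (fun j _ _ => hinit _ j (by omega) (by omega))
          (fun j _ _ => hinv j (by omega) (by omega))
        rw [zero_add] at this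
        rwa [show (N : ℤ) + 2 + 1 = N + 3 by ring]
    -- Regularity at the centre: `τ_{m+1}` is term `k` of the orbit started at `τ_{N+3}`, and the
    -- window `τ_{N+3}, …, τ_{2N+5}` consists of units there.
    · obtain ⟨k, hk⟩ : ∃ k : ℕ, m = k + (N + 2) := ⟨m - (N + 2), by omega⟩
      have := h.mem_of_mem hN (t := fun j => τ (j + (N + 3)))
        (fun n => MultiAt.shift _ (h.2 _)) (fun j => h₀ _) k
        (fun j k₁ k₂ => ih j k₁ (by omega))
        (hα (centerDenominators N)) (hβ _)
        (fun j k₁ k₂ => (h.confined hN h₀ (by omega) (by omega)).1)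
        (fun j k₁ k₂ => (h.confined hN h₀ (by omega) (by omega)).2 (by omega))
      rwa [show (k : ℤ) + (N + 3) = m + 1 by rw [hk]; push_cast; ring] at this

/-- The Laurent phenomenon. -/
theorem IsGenericOrbit.mem_laurentRing (hN : 2 ≤ N) {τ : ℤ → RatField N}
    (h : IsGenericOrbit N τ) (h₀ : ∀ j, τ j ≠ 0) (n : ℤ) : τ n ∈ laurentRing N := by
  have hα : alphaVar N ∈ laurentRing N := Subring.subset_closure (by simp)
  have hβ : betaVar N ∈ laurentRing N := Subring.subset_closure (by simp)
  have hτ : ∀ j : ℤ, 0 ≤ j → j ≤ N + 2 → τ j ∈ laurentRing N ∧ (τ j)⁻¹ ∈ laurentRing N := by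
    intro j h₁ h₂
    obtain ⟨i, -, hi⟩ := h.apply h₁ h₂
    rw [hi]
    exact ⟨Subring.subset_closure (Or.inl (Or.inr ⟨i, rfl⟩)),
      Subring.subset_closure (Or.inr ⟨i, rfl⟩)⟩
  rcases le_or_gt 0 n with hn | hn
  · lift n to ℕ using hn
    exact h.mem_of_mem hN h.2 h₀ n (h.mem_inner hN h₀ n) hα hβ
      (fun j h₁ h₂ => (hτ j h₁ h₂).1) (fun j h₁ h₂ => (hτ j h₁ (by omega)).2)
  · have := h.mem_of_mem hN (reverse_orbit h.2 hN) (fun j => h₀ _) (N + 2 - n).toNat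
      (h.mem_inner hN h₀ _) hα hβ
      (fun j h₁ h₂ => (hτ _ (by omega) (by omega)).1)
      (fun j h₁ h₂ => (hτ _ (by omega) (by omega)).2)
    rwa [show (N : ℤ) + 2 - ((N + 2 - n).toNat : ℤ) = n by omega] at this

end StrongLaurent

/-! ### From the multilinear relation to the DTKQ equation -/

section Substitution

theorem dtkqAt_tauSub {F : Type*} [Field F] {N : ℕ} (hN : 2 ≤ N) (α β : F) (τ : ℤ → F) (n : ℤ)
    (h : ∀ j ∈ Finset.Icc 1 (N + 2), τ (n + (j : ℤ)) ≠ 0) (H : MultiAt N α β τ n) :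
    DTKQAt N α β (tauSub τ) n := by
  have hP : ∏ j ∈ Finset.Icc 1 (N + 2), τ (n + j) ≠ 0 := Finset.prod_ne_zero_iff.2 h
  have key := multiLHS_sub_multiRHS hN α β τ (fun j => (τ j)⁻¹) n
    fun j hj => mul_inv_cancel₀ (h j hj)
  rw [sub_eq_zero.2 H, eq_comm, mul_eq_zero] at key
  have key := sub_eq_zero.1 (key.resolve_left hP)
  -- The product telescopes; the bound on `M` keeps every cancelled factor among the terms assumed
  -- nonzero.
  have hprod : ∀ M : ℕ, M + 1 ≤ N → ∏ k ∈ Finset.Icc 1 M, tauSub τ (n + k) =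
      τ (n + 1) * τ (n + M + 3) / (τ (n + 3) * τ (n + M + 1)) := by
    intro M hM
    have h3 := h 3 (by rw [Finset.mem_Icc]; omega)
    push_cast at h3
    induction M with
    | zero =>
      have h1 := h 1 (by rw [Finset.mem_Icc]; omega)
      push_cast at h1
      simp only [Finset.Icc_eq_empty_of_lt zero_lt_one, Finset.prod_empty, Nat.cast_zero, add_zero]
      field_simp
    | succ M ih =>
      have a1 := h (M + 1) (by rw [Finset.mem_Icc]; omega)
      have a2 := h (M + 2) (by rw [Finset.mem_Icc]; omega)
      have a3 := h (M + 3) (by rw [Finset.mem_Icc]; omega)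
      rw [Finset.prod_Icc_succ_top (by omega), ih (by omega), tauSub]
      push_cast at *
      simp only [← add_assoc] at *
      rw [show n + (M : ℤ) + 1 + 1 = n + M + 2 by ring, show n + (M : ℤ) + 1 + 2 = n + M + 3 by ring]
      field_simp
  unfold DTKQAt
  have hs : ∑ j ∈ Finset.Icc 0 N, tauSub τ (n + j) = ∑ j ∈ Finset.Icc 0 N,
      τ (n + j + 3) * τ (n + j) * ((τ (n + j + 2))⁻¹ * (τ (n + j + 1))⁻¹) :=
    Finset.sum_congr rfl fun j _ => by rw [tauSub, div_eq_mul_inv, mul_inv]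
  rw [hs, key, hprod (N - 1) (by omega)]
  have h1 := h 1 (by rw [Finset.mem_Icc]; omega)
  have h3 := h 3 (by rw [Finset.mem_Icc]; omega)
  have hN0 := h N (by rw [Finset.mem_Icc]; omega)
  have hN2 := h (N + 2) (by rw [Finset.mem_Icc]; omega)
  push_cast at *
  rw [show n + ((N - 1 : ℕ) : ℤ) + 3 = n + N + 2 by omega,
    show n + ((N - 1 : ℕ) : ℤ) + 1 = n + N by omega]
  rw [← add_assoc] at hN2
  field_simp

end Substitution

/-! ### Degree and order of the relation -/

section Polynomial

open MvPolynomial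

variable {F : Type*} [Field F]

theorem multiPoly_isHomogeneous {N : ℕ} (hN : 2 ≤ N) (α β : F) (n : ℤ) :
    (multiPoly N α β n).IsHomogeneous (N + 2) := by
  have hX : ∀ i : ℤ, (X i : MvPolynomial ℤ F).IsHomogeneous 1 := fun i => isHomogeneous_X _ _
  have hp : ∀ (s : Finset ℕ), (∏ j ∈ s, (X (n + (j : ℤ)) : MvPolynomial ℤ F)).IsHomogeneous
      s.card := fun s => by
    have := IsHomogeneous.prod s (fun j : ℕ => (X (n + (j : ℤ)) : MvPolynomial ℤ F)) (fun _ => 1)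
      fun j _ => hX _
    simpa using this
  have cast : ∀ {p : MvPolynomial ℤ F} {a b : ℕ}, p.IsHomogeneous a → a = b →
      p.IsHomogeneous b := fun h e => e ▸ h
  unfold multiPoly multiLHS multiRHS
  refine IsHomogeneous.sub ?_ (IsHomogeneous.sub (IsHomogeneous.sub (IsHomogeneous.sub ?_ ?_) ?_)
    (IsHomogeneous.sum _ _ _ fun k hk => ?_))
  · refine cast (((hX _).mul ((hX _).pow 2)).mul (hp _)) ?_
    rw [Nat.card_Icc]; omega
  · refine cast ((((isHomogeneous_C _ _).mul (hX _)).mul (hX _)).mul (hp _)) ?_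
    rw [Nat.card_Icc]; omega
  · refine cast ((isHomogeneous_C _ _).mul (hp _)) ?_
    rw [Nat.card_Icc]; omega
  · refine cast (((hX _).mul (hX _)).mul (hp _)) ?_
    rw [Nat.card_Icc]; omega
  · rw [Finset.mem_Icc] at hk
    have hs : ({k + 1, k + 2} : Finset ℕ) ⊆ Finset.Icc 1 (N + 2) := by
      intro x hx
      simp only [Finset.mem_insert, Finset.mem_singleton] at hx
      rw [Finset.mem_Icc]; omega
    refine cast (((hX _).mul (hX _)).mul (hp _)) ?_
    rw [Finset.card_sdiff_of_subset hs, Finset.card_pair (by omega), Nat.card_Icc]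
    omega

theorem multiPoly_vars_subset {N : ℕ} (hN : 2 ≤ N) (α β : F) (n : ℤ) :
    ((multiPoly N α β n).vars : Set ℤ) ⊆ Set.Icc n (n + N + 3) := by
  rw [← mem_supported]
  set A := supported F (Set.Icc n (n + N + 3)) with hA
  have hX : ∀ j : ℤ, n ≤ j → j ≤ n + N + 3 → (X j : MvPolynomial ℤ F) ∈ A.toSubring :=
    fun j h₁ h₂ => X_mem_supported.2 ⟨h₁, h₂⟩
  have hC : ∀ r : F, (C r : MvPolynomial ℤ F) ∈ A.toSubring := fun r => A.algebraMap_mem r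
  change _ ∈ A.toSubring
  rw [multiPoly, multiLHS_eq]
  exact A.toSubring.sub_mem (A.toSubring.mul_mem (hX _ (by omega) le_rfl)
    (topCoeff_mem _ fun j h₁ h₂ => hX j h₁ (by omega)))
    (multiRHS_mem hN _ (hC α) (hC β) fun j h₁ h₂ => hX j h₁ (by omega))

theorem eval_multiPoly (N : ℕ) (α β : F) (n : ℤ) (τ : ℤ → F) :
    eval τ (multiPoly N α β n) = multiLHS N τ n - multiRHS N α β τ n := by
  rw [multiPoly, map_sub, map_multiLHS, map_multiRHS]
  simp

theorem mem_vars_of_eval_ne {p : MvPolynomial ℤ F} {i : ℤ} {τ : ℤ → F} {x : F}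
    (h : eval (Function.update τ i x) p ≠ eval τ p) : i ∈ p.vars := by
  by_contra hi
  refine h (eval₂Hom_congr' rfl (fun j hj _ => Function.update_of_ne ?_ _ _) rfl)
  rintro rfl
  exact hi hj

theorem top_mem_vars {N : ℕ} (hN : 2 ≤ N) (α β : F) (n : ℤ) :
    n + N + 3 ∈ (multiPoly N α β n).vars := by
  refine mem_vars_of_eval_ne (τ := fun _ => 1) (x := 0) ?_
  have h : ∀ j : ℤ, n ≤ j → j ≤ n + N + 2 →
      Function.update (fun _ => (1 : F)) (n + N + 3) 0 j = 1 := fun j _ _ =>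
    Function.update_of_ne (by omega) _ _
  rw [eval_multiPoly, eval_multiPoly, multiLHS_eq, multiLHS_eq, multiRHS_congr hN h,
    topCoeff_congr h, topCoeff_one, Function.update_self]
  intro e
  exact one_ne_zero (α := F) (by linear_combination -e)

/-- The variable of index `n` occurs in a single term, with coefficient of absolute size one, so at
the all-ones point changing it from `1` to `0` changes the value by `1`, whatever the
characteristic. -/
theorem bot_mem_vars {N : ℕ} (hN : 2 ≤ N) (α β : F) (n : ℤ) :
    n ∈ (multiPoly N α β n).vars := by
  refine mem_vars_of_eval_ne (τ := fun _ => 1) (x := 0) ?_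
  have h : ∀ j : ℤ, n < j → Function.update (fun _ => (1 : F)) n 0 j = 1 := fun j _ =>
    Function.update_of_ne (by omega) _ _
  have hs : ∀ s : Finset ℕ, 0 ∉ s →
      ∏ j ∈ s, Function.update (fun _ => (1 : F)) n 0 (n + j) = 1 := fun s hs =>
    Finset.prod_eq_one fun j hj => h _ (by
      have : j ≠ 0 := fun e => hs (e ▸ hj)
      omega)
  have hk : ∑ k ∈ Finset.Icc 1 (N - 1), Function.update (fun _ => (1 : F)) n 0 (n + k) *
      Function.update (fun _ => (1 : F)) n 0 (n + k + 3) *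
        ∏ j ∈ Finset.Icc 1 (N + 2) \ {k + 1, k + 2},
          Function.update (fun _ => (1 : F)) n 0 (n + j) =
      ∑ k ∈ Finset.Icc 1 (N - 1), 1 := by
    refine Finset.sum_congr rfl fun k hk => ?_
    rw [Finset.mem_Icc] at hk
    rw [h _ (by omega), h _ (by omega), hs _ (by simp)]
    simp
  rw [eval_multiPoly, eval_multiPoly, multiLHS, multiRHS, multiLHS, multiRHS, hk,
    hs _ (by simp), hs _ (by simp), hs _ (by simp), hs _ (by simp), h _ (by omega),
    h _ (by omega), h _ (by omega), Function.update_self]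
  intro e
  simp at e
  exact one_ne_zero (α := F) (by linear_combination e)

end Polynomial

end GenDTKQ

theorem proposition2 (N : ℕ) (hN : 2 ≤ N) :
    -- the substitution turns solutions of the multilinear relation into solutions of DTKQ
    (∀ {F : Type*} [Field F] (α β : F) (τ : ℤ → F) (n : ℤ),
      (∀ j ∈ Finset.Icc 1 (N + 2), τ (n + (j : ℤ)) ≠ 0) →
        GenDTKQ.MultiAt N α β τ n → GenDTKQ.DTKQAt N α β (GenDTKQ.tauSub τ) n) ∧
    -- the relation is homogeneous of degree `N + 2` and of order `N + 3`
    (∀ {F : Type*} [Field F] (α β : F) (n : ℤ),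
      (GenDTKQ.multiPoly N α β n).IsHomogeneous (N + 2) ∧
      IsLeast ((GenDTKQ.multiPoly N α β n).vars : Set ℤ) n ∧
      IsGreatest ((GenDTKQ.multiPoly N α β n).vars : Set ℤ) (n + N + 3)) ∧
    -- the iterates in both directions are well defined, and they are Laurent polynomials
    (∃ τ : ℤ → GenDTKQ.RatField N,
      GenDTKQ.IsGenericOrbit N τ ∧
      (∀ τ' : ℤ → GenDTKQ.RatField N, GenDTKQ.IsGenericOrbit N τ' → τ' = τ) ∧
      (∀ n : ℤ, τ n ≠ 0) ∧
      (∀ n : ℤ, τ n ∈ GenDTKQ.laurentRing N)) := by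
  refine ⟨fun α β τ n h H => GenDTKQ.dtkqAt_tauSub hN α β τ n h H, fun α β n =>
    ⟨GenDTKQ.multiPoly_isHomogeneous hN α β n,
      ⟨GenDTKQ.bot_mem_vars hN α β n,
        fun j hj => (GenDTKQ.multiPoly_vars_subset hN α β n hj).1⟩,
      ⟨GenDTKQ.top_mem_vars hN α β n,
        fun j hj => (GenDTKQ.multiPoly_vars_subset hN α β n hj).2⟩⟩, ?_⟩
  obtain ⟨τ, h, h₀⟩ := GenDTKQ.exists_genericOrbit hN
  refine ⟨τ, h, fun τ' h' => GenDTKQ.orbit_unique hN h₀ h.2 h'.2 fun j h₁ h₂ => ?_, h₀,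
    h.mem_laurentRing hN h₀⟩
  obtain ⟨i, rfl, hi⟩ := h.apply h₁ h₂
  rw [hi, h'.1]
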